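/- Let $\mathbb N=\{1,2,3,\dots\}$ and let $\mathcal S_\infty$ be the group of permutations of $\mathbb N$ that fix all but finitely many numbers, with identity $e$; $\mathcal S_n$ is the subgroup of those fixing every $i>n$. The length $\ell(w)$ of $w\in\mathcal S_\infty$ is the number of pairs $a<b$ with $w(a)>w(b)$, and $(a,b)$ denotes the transposition interchanging $a<b$. The Bruhat order is defined by its covers: $u\lessdot u(a,b)$ if and only if $\ell(u(a,b))=\ell(u)+1$. For $I\subset\mathbb N$, an $I$-chain from $u$ to $w$ is a saturated chain $u=u_0\lessdot u_1\lessdot\cdots\lessdot u_m=w$ $(m\ge 0)$ in the Bruhat order together with, for each cover $u_{j-1}\lessdot u_j=u_{j-1}(a,b)$, $a<b$, a colour in $\{a,a+1,\dots,b-1\}\cap I$. Let $f^w_u(I)$ be the number of $I$-chains from $u$ to $w$ (so $f^w_u(I)=0$ if there are none). For $w\in\mathcal S_n$ with longest element $w_0\in\mathcal S_n$, the Schubert polynomial is $\mathfrak S_w=\partial_{i_1}\cdots\partial_{i_r}\bigl(x_1^{n-1}x_2^{n-2}\cdots x_{n-1}\bigr)\in\mathbb Z[x_1,x_2,\dots]$,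 where $w^{-1}w_0=s_{i_1}\cdots s_{i_r}$ is a reduced expression in the transpositions $s_i=(i,i+1)$ and $\partial_i f=(f-s_if)/(x_i-x_{i+1})$, with $s_i$ acting by exchanging $x_i$ and $x_{i+1}$; this does not depend on the choices made. **Theorem 1.1.** The Schubert polynomials $\mathfrak S_w$, $w\in\mathcal S_\infty$, form a $\mathbb Z$-basis of $\mathbb Z[x_1,x_2,\dots]$, so that $\mathfrak S_u\cdot\mathfrak S_v=\sum_w c^w_{u\,v}\,\mathfrak S_w$ defines integers $c^w_{u\,v}$. For all $u,w\in\mathcal S_\infty$ and all $I\subset\mathbb N$, the number of $I$-chains from $u$ to $w$ is finite, only finitely many $v\in\mathcal S_\infty$ have $c^w_{u\,v}f^v_e(I)\neq0$, and $$f^w_u(I)=\sum_{v\in\mathcal S_\infty}c^w_{u\,v}\,f^v_e(I).$$ -/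

import Mathlib

/-! Indexing convention: the positive integers `1, 2, 3, …` that the permutations act on, that index
the variables, and that serve as colours are represented by the natural numbers `0, 1, 2, …`
(that is, `i : ℕ` stands for the positive integer `i + 1`). -/

/-- The group `𝒮_∞` of permutations fixing all but finitely many numbers. -/
def finitaryPerm : Subgroup (Equiv.Perm ℕ) where
  carrier := {w | {i | w i ≠ i}.Finite}
  one_mem' := by simp
  mul_mem' := by
    intro u w hu hw
    refine (hu.union hw).subset fun i hi => ?_
    by_contra h
    simp only [Set.mem_union, Set.mem_ofPred_eq, not_or, not_not] at h
    exact hi (by rw [Equiv.Perm.mul_apply, h.2, h.1])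
  inv_mem' := by
    intro w hw
    refine Set.Finite.subset hw fun i hi h => hi ?_
    rw [Equiv.Perm.inv_eq_iff_eq]
    exact h.symm

/-- `𝒮_∞` as a type. -/
abbrev SInf : Type := finitaryPerm

namespace SInf

/-- The transposition `(a, b)`. -/
def transp (a b : ℕ) : SInf :=
  ⟨Equiv.swap a b, by
    refine (Set.toFinite ({a, b} : Set ℕ)).subset fun i hi => ?_
    by_contra h
    simp only [Set.mem_insert_iff, Set.mem_singleton_iff, not_or] at h
    exact hi (Equiv.swap_apply_of_ne_of_ne h.1 h.2)⟩

/-- The length `ℓ(w)`: the number of inversions of `w`. -/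
noncomputable def length (w : SInf) : ℕ :=
  {p : ℕ × ℕ | p.1 < p.2 ∧ w.1 p.2 < w.1 p.1}.ncard

/-- The least `n` such that `w` only moves the first `n` numbers, i.e. such that `w ∈ 𝒮_n`. -/
noncomputable def rank (w : SInf) : ℕ :=
  sInf {n | ∀ i, n ≤ i → w.1 i = i}

end SInf

/-- An `I`-chain from `u` to `w`: a saturated chain in the Bruhat order, whose covers are
`u ⋖ u (a, b)` with `a < b` and `ℓ(u) + 1 = ℓ(u (a, b))`, together with, for each cover
`u ⋖ u (a, b)` of the chain, a colour in `{a, a + 1, …, b - 1}` that belongs to `I`. -/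
inductive IChain (I : Set ℕ) : SInf → SInf → Type
  | nil (u : SInf) : IChain I u u
  | cons {u w : SInf} (a b k : ℕ) (hab : a < b)
      (hcover : u.length + 1 = (u * SInf.transp a b).length)
      (hak : a ≤ k) (hkb : k < b) (hkI : k ∈ I)
      (rest : IChain I (u * SInf.transp a b) w) : IChain I u w

/-- `f^w_u(I)`: the number of `I`-chains from `u` to `w`. -/
noncomputable def chainCount (I : Set ℕ) (u w : SInf) : ℕ :=
  Nat.card (IChain I u w)

open MvPolynomial in
/-- The polynomial `x_i - x_{i+1}` divides `f - s_i f`. -/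
theorem X_sub_X_succ_dvd (i : ℕ) (f : MvPolynomial ℕ ℤ) :
    (X i - X (i + 1) : MvPolynomial ℕ ℤ) ∣ f - rename (Equiv.swap i (i + 1)) f := by
  induction f using MvPolynomial.induction_on with
  | C a => simp
  | add p q hp hq =>
    rw [map_add, add_sub_add_comm]
    exact dvd_add hp hq
  | mul_X p j hp =>
    have hj : (X i - X (i + 1) : MvPolynomial ℕ ℤ) ∣ X j - X (Equiv.swap i (i + 1) j) := by
      by_cases h1 : j = i
      · subst h1
        simp
      · by_cases h2 : j = i + 1
        · subst h2
          rw [Equiv.swap_apply_right]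
          exact ⟨-1, by ring⟩
        · simp [Equiv.swap_apply_of_ne_of_ne h1 h2]
    have h : p * X j - rename (Equiv.swap i (i + 1)) (p * X j) =
        (p - rename (Equiv.swap i (i + 1)) p) * X j +
          rename (Equiv.swap i (i + 1)) p * (X j - X (Equiv.swap i (i + 1) j)) := by
      rw [map_mul, rename_X]
      ring
    rw [h]
    exact dvd_add (Dvd.dvd.mul_right hp _) (Dvd.dvd.mul_left hj _)

/-- The divided difference `∂_i f = (f - s_i f) / (x_i - x_{i+1})`, the unique polynomial `g` with
`f - s_i f = (x_i - x_{i+1}) g`. -/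
noncomputable def dividedDiff (i : ℕ) (f : MvPolynomial ℕ ℤ) : MvPolynomial ℕ ℤ :=
  (X_sub_X_succ_dvd i f).choose

/-- The monomial `x₁^{n-1} x₂^{n-2} ⋯ x_{n-1}` (variables numbered from `1`). -/
noncomputable def staircase (n : ℕ) : MvPolynomial ℕ ℤ :=
  ∏ i ∈ Finset.range n, MvPolynomial.X i ^ (n - 1 - i)

open Classical in
/-- Descending recursion from the longest element `w₀` of `𝒮_n`: the polynomial of `w₀` is
`x₁^{n-1} ⋯ x_{n-1}`, and if `w ≠ w₀` then `w` has an ascent `w(i) < w(i+1)` within `𝒮_n`, and the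
polynomial of `w` is `∂_i` of the polynomial of `w s_i`. The first ascent is used; the second
argument bounds the number of steps. -/
noncomputable def schubertAux (n : ℕ) : ℕ → SInf → MvPolynomial ℕ ℤ
  | 0, _ => staircase n
  | m + 1, w =>
    if h : ∃ i, i + 1 < n ∧ w.1 i < w.1 (i + 1) then
      dividedDiff (Nat.find h)
        (schubertAux n m (w * SInf.transp (Nat.find h) (Nat.find h + 1)))
    else staircase n

/-- The Schubert polynomial `𝔖_w = ∂_{w⁻¹ w₀} (x₁^{n-1} x₂^{n-2} ⋯ x_{n-1})`, where `w ∈ 𝒮_n` and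
`w₀` is the longest element of `𝒮_n`. It takes `n (n - 1) / 2 - ℓ(w)` steps to reach `w₀`. -/
noncomputable def schubert (w : SInf) : MvPolynomial ℕ ℤ :=
  schubertAux w.rank (w.rank.choose 2) w

open Classical in
/-- The structure constant `c^w_{u v}`: the coefficient of `𝔖_w` in the expansion of `𝔖_u 𝔖_v` in
the `ℤ`-basis of Schubert polynomials. (The
value `0` would only be taken if they were not a basis.) -/
noncomputable def structureConst (u v w : SInf) : ℤ :=
  if h : ∃ B : Module.Basis SInf ℤ (MvPolynomial ℕ ℤ), ∀ x, B x = schubert x then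
    h.choose.repr (schubert u * schubert v) w
  else 0

/-!
Write `∂_i` for the divided differences, `s_i = (i, i + 1)`, and count positions, variables and
colours from `0`, so that `s_k` has the Schubert polynomial `x_0 + ⋯ + x_k`.

The divided differences satisfy the commutation and braid relations, hence in the recursion for the
polynomial of `w` inside `𝒮_n` any ascent may be used in place of the first one, and the result does
not change when `n` grows. So `∂_i 𝔖_w = 𝔖_{w s_i}` if `w` has a descent at `i`, and `∂_i 𝔖_w = 0`
otherwise (`dividedDiff_schubert_of_descent`, `dividedDiff_schubert_of_ascent`).

A polynomial killed by all `∂_i` is constant. This gives, by induction on the length, Monk's rule for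
a variable (`X_mul_schubert`): `x_k 𝔖_w` is the sum of the `𝔖_{w (k, j)}` over the covers
`w ⋖ w (k, j)` with `k < j`, minus the sum over those with `j < k`. The span of the Schubert
polynomials is therefore an ideal containing `1`, that is, everything. They are independent because
divided differences reduce a linear relation to shorter permutations.

Summing over the variables `x_0, …, x_k` leaves Monk's rule: `(x_0 + ⋯ + x_k) 𝔖_u` is the sum of the
`𝔖_{u (a, b)}` over the covers with `a ≤ k < b`. Let `q` be the sum of these linear forms over the
`k ∈ I` with `k < n`. For `w ∈ 𝒮_n` with `ℓ(w) = ℓ(u) + m`, the coefficient of `𝔖_w` in `q^m 𝔖_u` is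
`f^w_u(I)` (`repr_colourForm_pow_mul`), as chains ending in `𝒮_n` only use colours below `n`.
Expanding `q^m` itself in the Schubert basis, its coefficient at `𝔖_v` is `f^v_e(I)` whenever
`v ∈ 𝒮_n` and `ℓ(v) = m`. Both conditions hold if `c^w_{u v} ≠ 0`: the second by homogeneity, the first
because the Schubert polynomials of permutations outside `𝒮_n` span an ideal. Comparing coefficients
of `𝔖_w` in `q^m 𝔖_u` proves the identity, and the finitely many `v` occurring in `q^m` are the only
ones that can contribute.
-/

/-! ### Inversions and covers -/

namespace SInf

theorem mul_transp_apply (w : SInf) (a b i : ℕ) :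
    (w * transp a b).1 i = w.1 (Equiv.swap a b i) := rfl

@[simp] theorem one_apply (i : ℕ) : (1 : SInf).1 i = i := rfl

theorem mul_transp_left (w : SInf) (a b : ℕ) : (w * transp a b).1 a = w.1 b := by
  rw [mul_transp_apply, Equiv.swap_apply_left]

theorem mul_transp_right (w : SInf) (a b : ℕ) : (w * transp a b).1 b = w.1 a := by
  rw [mul_transp_apply, Equiv.swap_apply_right]

theorem mul_transp_of_ne (w : SInf) {a b c : ℕ} (ha : c ≠ a) (hb : c ≠ b) :
    (w * transp a b).1 c = w.1 c := by
  rw [mul_transp_apply, Equiv.swap_apply_of_ne_of_ne ha hb]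

theorem ext_apply {u w : SInf} (h : ∀ i, u.1 i = w.1 i) : u = w :=
  Subtype.ext (Equiv.ext h)

theorem transp_comm (a b : ℕ) : transp a b = transp b a :=
  Subtype.ext (Equiv.swap_comm a b)

theorem transp_mul_transp_self (a b : ℕ) : transp a b * transp a b = 1 :=
  Subtype.ext (Equiv.swap_mul_self a b)

theorem mul_transp_cancel (w : SInf) (a b : ℕ) : w * transp a b * transp a b = w := by
  rw [mul_assoc, transp_mul_transp_self, mul_one]

theorem mul_transp_conj (w : SInf) (i a b : ℕ) :
    w * transp i (i + 1) * transp a b * transp i (i + 1) =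
      w * transp (Equiv.swap i (i + 1) a) (Equiv.swap i (i + 1) b) := by
  have h : transp i (i + 1) * transp a b * transp i (i + 1) =
      transp (Equiv.swap i (i + 1) a) (Equiv.swap i (i + 1) b) := by
    apply Subtype.ext
    change Equiv.swap i (i + 1) * Equiv.swap a b * Equiv.swap i (i + 1) = Equiv.swap _ _
    have := Equiv.mul_swap_eq_swap_mul (Equiv.swap i (i + 1)) a b
    rw [this, mul_assoc, Equiv.swap_mul_self, mul_one]
  rw [← h]
  simp only [mul_assoc]

theorem swap_swap (a b c : ℕ) : Equiv.swap a b (Equiv.swap a b c) = c := by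
  rw [← Equiv.Perm.mul_apply, Equiv.swap_mul_self, Equiv.Perm.one_apply]

theorem apply_ne (w : SInf) {a b : ℕ} (h : a ≠ b) : w.1 a ≠ w.1 b :=
  fun h' => h (w.1.injective h')

/-- `w` fixes every number from `n` on, i.e. `w` belongs to the finite symmetric group `𝒮_n`. -/
def Fixes (n : ℕ) (w : SInf) : Prop := ∀ i, n ≤ i → w.1 i = i

theorem fixes_one (n : ℕ) : Fixes n 1 := fun _ _ => rfl

theorem Fixes.mono {m n : ℕ} {w : SInf} (h : Fixes m w) (hmn : m ≤ n) : Fixes n w :=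
  fun i hi => h i (hmn.trans hi)

theorem exists_fixes (w : SInf) : ∃ n, Fixes n w := by
  have hw : {i | w.1 i ≠ i}.Finite := w.2
  obtain ⟨n, hn⟩ := hw.bddAbove
  refine ⟨n + 1, fun i hi => ?_⟩
  by_contra h
  have : i ≤ n := hn h
  omega

theorem fixes_rank (w : SInf) : Fixes w.rank w := Nat.sInf_mem (exists_fixes w)

theorem Fixes.apply_lt {n : ℕ} {w : SInf} (h : Fixes n w) {i : ℕ} (hi : i < n) : w.1 i < n := by
  by_contra hc
  have := w.1.injective (h (w.1 i) (not_lt.mp hc))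
  omega

theorem Fixes.mul_transp {n : ℕ} {w : SInf} (h : Fixes n w) {a b : ℕ} (ha : a < n) (hb : b < n) :
    Fixes n (w * transp a b) := by
  intro i hi
  rw [mul_transp_of_ne w (by omega) (by omega), h i hi]

/-- All inversions of an element of `𝒮_n` are among the first `n` positions. -/
theorem Fixes.lt_of_inv {n : ℕ} {w : SInf} (h : Fixes n w) {a b : ℕ} (hab : a < b)
    (hw : w.1 b < w.1 a) : b < n := by
  by_contra hc
  rw [h b (by omega)] at hw
  have := w.1.injective (h (w.1 a) (by omega))
  omega

@[simp] theorem length_one : length 1 = 0 := by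
  have h : {p : ℕ × ℕ | p.1 < p.2 ∧ (1 : SInf).1 p.2 < (1 : SInf).1 p.1} = ∅ := by
    ext p
    simp only [one_apply, Set.mem_ofPred_eq, Set.mem_empty_iff_false, iff_false]
    omega
  rw [length, h, Set.ncard_empty]

theorem ncard_pairs_lt (n : ℕ) : {p : ℕ × ℕ | p.1 < p.2 ∧ p.2 < n}.ncard = n.choose 2 := by
  have h : {p : ℕ × ℕ | p.1 < p.2 ∧ p.2 < n} =
      ((Finset.range n).sigma fun b => Finset.range b).image (fun q => (q.2, q.1)) := by
    ext ⟨a, b⟩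
    simp only [Set.mem_ofPred_eq, Finset.coe_image, Set.mem_image, Finset.mem_coe,
      Finset.mem_sigma, Finset.mem_range, Prod.mk.injEq, Sigma.exists]
    constructor
    · rintro ⟨h1, h2⟩
      exact ⟨b, a, ⟨h2, h1⟩, rfl, rfl⟩
    · rintro ⟨_, _, ⟨h1, h2⟩, rfl, rfl⟩
      exact ⟨h2, h1⟩
  rw [h, Set.ncard_coe_finset, Finset.card_image_of_injective, Finset.card_sigma]
  · simp only [Finset.card_range]
    rw [Finset.sum_range_id, Nat.choose_two_right]
  · rintro ⟨a, b⟩ ⟨c, d⟩ he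
    simp only [Prod.mk.injEq] at he
    obtain ⟨rfl, rfl⟩ := he
    rfl

theorem finite_pairs_lt (n : ℕ) : {p : ℕ × ℕ | p.1 < p.2 ∧ p.2 < n}.Finite := by
  refine (Set.finite_Iio n |>.prod (Set.finite_Iio n)).subset ?_
  rintro ⟨a, b⟩ ⟨hab, hb⟩
  exact ⟨lt_trans hab hb, hb⟩

theorem finite_inversions (w : SInf) :
    {p : ℕ × ℕ | p.1 < p.2 ∧ w.1 p.2 < w.1 p.1}.Finite := by
  obtain ⟨n, hn⟩ := exists_fixes w
  exact (finite_pairs_lt n).subset fun p hp => ⟨hp.1, hn.lt_of_inv hp.1 hp.2⟩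

theorem Fixes.length_le {n : ℕ} {w : SInf} (h : Fixes n w) : w.length ≤ n.choose 2 := by
  rw [← ncard_pairs_lt]
  exact Set.ncard_le_ncard (fun p hp => ⟨hp.1, h.lt_of_inv hp.1 hp.2⟩) (finite_pairs_lt n)

theorem Fixes.length_eq {n : ℕ} {w : SInf} (h : Fixes n w)
    (hw : ∀ a b, a < b → b < n → w.1 b < w.1 a) : w.length = n.choose 2 := by
  rw [← ncard_pairs_lt, length]
  congr 1
  ext p
  exact ⟨fun hp => ⟨hp.1, h.lt_of_inv hp.1 hp.2⟩, fun hp => ⟨hp.1, hw _ _ hp.1 hp.2⟩⟩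

theorem swap_succ_lt {i a b : ℕ} (hab : a < b) (h : ¬ (a = i ∧ b = i + 1)) :
    Equiv.swap i (i + 1) a < Equiv.swap i (i + 1) b := by
  simp only [Equiv.swap_apply_def]
  split_ifs <;> omega

theorem length_mul_succ {w : SInf} {i : ℕ} (h : w.1 i < w.1 (i + 1)) :
    (w * transp i (i + 1)).length = w.length + 1 := by
  set s := Equiv.swap i (i + 1) with hs
  have key : {p : ℕ × ℕ | p.1 < p.2 ∧
      (w * transp i (i + 1)).1 p.2 < (w * transp i (i + 1)).1 p.1} =
      insert (i, i + 1) ((fun p : ℕ × ℕ => (s p.1, s p.2)) ''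
        {p : ℕ × ℕ | p.1 < p.2 ∧ w.1 p.2 < w.1 p.1}) := by
    ext ⟨a, b⟩
    simp only [Set.mem_ofPred_eq, Set.mem_insert_iff, Prod.mk.injEq, Set.mem_image, Prod.exists,
      mul_transp_apply, ← hs]
    constructor
    · rintro ⟨hab, hw⟩
      by_cases hc : a = i ∧ b = i + 1
      · exact Or.inl hc
      · exact Or.inr ⟨s a, s b, ⟨swap_succ_lt hab hc, hw⟩, swap_swap ..,
          swap_swap ..⟩
    · rintro (⟨rfl, rfl⟩ | ⟨a, b, ⟨hab, hw⟩, rfl, rfl⟩)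
      · refine ⟨by omega, ?_⟩
        rw [hs, Equiv.swap_apply_left, Equiv.swap_apply_right]
        exact h
      · have hc : ¬ (a = i ∧ b = i + 1) := by
          rintro ⟨rfl, rfl⟩
          omega
        refine ⟨swap_succ_lt hab hc, ?_⟩
        rwa [hs, swap_swap, swap_swap]
  rw [length, key, Set.ncard_insert_of_notMem _ ((finite_inversions w).image _),
    Set.ncard_image_of_injective, length]
  · rintro ⟨a, b⟩ ⟨c, d⟩ he
    simp only [Prod.mk.injEq, EmbeddingLike.apply_eq_iff_eq] at he
    exact Prod.ext he.1 he.2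
  · rintro ⟨⟨a, b⟩, ⟨hab, -⟩, he⟩
    simp only [Prod.mk.injEq] at he
    have h1 : a = i + 1 := by
      rw [← swap_swap i (i + 1) a, ← hs, he.1, hs, Equiv.swap_apply_left]
    have h2 : b = i := by
      rw [← swap_swap i (i + 1) b, ← hs, he.2, hs, Equiv.swap_apply_right]
    simp only at hab
    omega

theorem length_mul_pred {w : SInf} {i : ℕ} (h : w.1 (i + 1) < w.1 i) :
    w.length = (w * transp i (i + 1)).length + 1 := by
  have := length_mul_succ (w := w * transp i (i + 1)) (i := i)
    (by rwa [mul_transp_left, mul_transp_right])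
  rwa [mul_transp_cancel] at this

theorem transp_succ_conj {a b : ℕ} (hab : a + 1 < b) (w : SInf) :
    w * transp a (a + 1) * transp (a + 1) b * transp a (a + 1) = w * transp a b := by
  rw [mul_transp_conj, Equiv.swap_apply_right, Equiv.swap_apply_of_ne_of_ne (by omega) (by omega)]

/-- Exchanging the values at `a < b` of an ascending pair increases the length. -/
theorem length_lt_mul_transp {a b : ℕ} (hab : a < b) {w : SInf} (h : w.1 a < w.1 b) :
    w.length < (w * transp a b).length := by
  induction hd : b - a - 1 generalizing a w with
  | zero =>
    obtain rfl : b = a + 1 := by omega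
    rw [length_mul_succ h]
    omega
  | succ d ih =>
    have hab' : a + 1 < b := by omega
    -- the outer factors of `(a, b) = s_a (a + 1, b) s_a` change the length by one each, and at
    -- least one of them raises it
    set v := w * transp a (a + 1) with hv
    have hva : v.1 a = w.1 (a + 1) := mul_transp_left ..
    have hva1 : v.1 (a + 1) = w.1 a := mul_transp_right ..
    have hvb : v.1 b = w.1 b := mul_transp_of_ne _ (by omega) (by omega)
    have h1 := ih (a := a + 1) (w := v) hab' (by rwa [hva1, hvb]) (by omega)
    set x := v * transp (a + 1) b with hx
    have hxa : x.1 a = w.1 (a + 1) := by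
      rw [← hva]; exact mul_transp_of_ne _ (by omega) (by omega)
    have hxa1 : x.1 (a + 1) = w.1 b := by rw [← hvb]; exact mul_transp_left ..
    have h2 : x * transp a (a + 1) = w * transp a b := transp_succ_conj hab' w
    have hne1 := apply_ne w (a := a) (b := a + 1) (by omega)
    have hne2 := apply_ne w (a := a + 1) (b := b) (by omega)
    rw [← h2]
    rcases lt_or_gt_of_ne hne1 with h3 | h3
    · have e1 := length_mul_succ h3
      rw [← hv] at e1
      rcases lt_or_gt_of_ne hne2 with h4 | h4
      · have e2 := length_mul_succ (w := x) (i := a) (by rwa [hxa, hxa1])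
        omega
      · have e2 := length_mul_pred (w := x) (i := a) (by rwa [hxa, hxa1])
        omega
    · have e1 := length_mul_pred h3
      rw [← hv] at e1
      have e2 := length_mul_succ (w := x) (i := a) (by rw [hxa, hxa1]; omega)
      omega

theorem lt_of_length_lt {a b : ℕ} (hab : a < b) {w : SInf}
    (h : w.length < (w * transp a b).length) : w.1 a < w.1 b := by
  by_contra hc
  have hne := apply_ne w hab.ne
  have := length_lt_mul_transp (w := w * transp a b) hab
    (by rw [mul_transp_left, mul_transp_right]; omega)
  rw [mul_transp_cancel] at this
  omega

theorem lt_of_cover {a b : ℕ} (hab : a < b) {w : SInf}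
    (h : w.length + 1 = (w * transp a b).length) : w.1 a < w.1 b :=
  lt_of_length_lt hab (by omega)

/-- A cover `w ⋖ w (a, b)` has no position between `a` and `b` whose value lies between `w a` and
`w b`: otherwise `(a, b) = (a, c) (c, b) (a, c)` would raise the length three times. -/
theorem not_between_of_cover {a b c : ℕ} (hac : a < c) (hcb : c < b) {w : SInf}
    (h : w.length + 1 = (w * transp a b).length) : ¬ (w.1 a < w.1 c ∧ w.1 c < w.1 b) := by
  rintro ⟨h1, h2⟩
  have e1 := length_lt_mul_transp hac h1
  set x := w * transp a c with hx
  have hxa : x.1 a = w.1 c := mul_transp_left ..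
  have hxc : x.1 c = w.1 a := mul_transp_right ..
  have hxb : x.1 b = w.1 b := mul_transp_of_ne _ (by omega) (by omega)
  have e2 := length_lt_mul_transp (w := x) hcb (by omega)
  set y := x * transp c b with hy
  have hya : y.1 a = w.1 c := by rw [← hxa]; exact mul_transp_of_ne _ (by omega) (by omega)
  have hyc : y.1 c = w.1 b := by rw [← hxb]; exact mul_transp_left ..
  have e3 := length_lt_mul_transp (w := y) hac (by omega)
  have : y * transp a c = w * transp a b := by
    apply ext_apply
    intro i
    simp only [hy, hx, mul_transp_apply]
    congr 1
    simp only [Equiv.swap_apply_def]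
    split_ifs <;> omega
  rw [this] at e3
  omega

/-- If `i` is an ascent of `w` and a descent of a cover `w (a, b)`, then `(a, b) = s_i`. -/
theorem eq_of_cover_of_descent {a b i : ℕ} (hab : a < b) {w : SInf}
    (h : w.length + 1 = (w * transp a b).length) (hi : w.1 i < w.1 (i + 1))
    (hd : (w * transp a b).1 (i + 1) < (w * transp a b).1 i) : a = i ∧ b = i + 1 := by
  have hlt := lt_of_cover hab h
  have hbet := fun c hac hcb => not_between_of_cover (c := c) hac hcb h
  rw [mul_transp_apply, mul_transp_apply] at hd
  by_contra hc
  have h0 := hbet i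
  have h1 := hbet (i + 1)
  have hne := apply_ne w (a := i) (b := i + 1) (by omega)
  simp only [Equiv.swap_apply_def] at hd
  split_ifs at hd <;> subst_vars <;> omega

theorem Fixes.of_cover {n a b : ℕ} (hab : a < b) {w : SInf}
    (h : w.length + 1 = (w * transp a b).length) (hn : Fixes n (w * transp a b)) :
    b < n ∧ Fixes n w := by
  have hlt := lt_of_cover hab h
  have hb : b < n := hn.lt_of_inv hab (by rwa [mul_transp_left, mul_transp_right])
  refine ⟨hb, ?_⟩
  have := hn.mul_transp (a := a) (b := b) (by omega) hb
  rwa [mul_transp_cancel] at this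

theorem exists_descent {w : SInf} (hw : w ≠ 1) : ∃ i, w.1 (i + 1) < w.1 i := by
  by_contra hc
  push Not at hc
  refine hw (ext_apply ?_)
  have hm : StrictMono w.1 := strictMono_nat_of_lt_succ fun i =>
    lt_of_le_of_ne (hc i) (apply_ne w (by omega))
  obtain ⟨n, hn⟩ := exists_fixes w
  intro i
  have h1 : i ≤ w.1 i := hm.le_apply
  have h2 : w.1 i ≤ i := by
    by_contra h2
    have h3 := hm (show i < w.1 i by omega)
    -- `w⁻¹` is strictly monotone as well
    have h4 : StrictMono w.1.symm := fun x y hxy => by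
      by_contra h5
      have := hm.monotone (not_lt.mp h5)
      simp only [Equiv.apply_symm_apply] at this
      omega
    have h5 := h4.le_apply (x := w.1 i)
    simp only [Equiv.symm_apply_apply] at h5
    omega
  exact le_antisymm h2 h1

end SInf

/-! ### Divided differences -/

section DividedDifferences

open MvPolynomial

theorem X_sub_X_ne_zero {i j : ℕ} (h : i ≠ j) : (X i - X j : MvPolynomial ℕ ℤ) ≠ 0 :=
  sub_ne_zero.mpr fun he => h (X_injective he)

theorem dividedDiff_spec (i : ℕ) (f : MvPolynomial ℕ ℤ) :
    f - rename (Equiv.swap i (i + 1)) f = (X i - X (i + 1)) * dividedDiff i f :=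
  (X_sub_X_succ_dvd i f).choose_spec

theorem dividedDiff_eq {i : ℕ} {f g : MvPolynomial ℕ ℤ}
    (h : f - rename (Equiv.swap i (i + 1)) f = (X i - X (i + 1)) * g) : dividedDiff i f = g := by
  rw [dividedDiff_spec] at h
  exact mul_left_cancel₀ (X_sub_X_ne_zero (by omega)) h

theorem dividedDiff_eq_zero {i : ℕ} {f : MvPolynomial ℕ ℤ}
    (h : rename (Equiv.swap i (i + 1)) f = f) : dividedDiff i f = 0 :=
  dividedDiff_eq (by rw [h]; ring)

theorem rename_eq_of_dividedDiff_eq_zero {i : ℕ} {f : MvPolynomial ℕ ℤ}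
    (h : dividedDiff i f = 0) : rename (Equiv.swap i (i + 1)) f = f := by
  have := dividedDiff_spec i f
  rw [h, mul_zero] at this
  exact (sub_eq_zero.mp this).symm

/-- The divided difference `∂_i` as a linear map. -/
noncomputable def dividedDiffLin (i : ℕ) : MvPolynomial ℕ ℤ →ₗ[ℤ] MvPolynomial ℕ ℤ where
  toFun := dividedDiff i
  map_add' f g := dividedDiff_eq (by
    rw [map_add, mul_add, ← dividedDiff_spec, ← dividedDiff_spec]; ring)
  map_smul' c f := dividedDiff_eq (by
    rw [map_zsmul, RingHom.id_apply, mul_smul_comm, ← dividedDiff_spec, smul_sub])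

@[simp] theorem dividedDiffLin_apply (i : ℕ) (f : MvPolynomial ℕ ℤ) :
    dividedDiffLin i f = dividedDiff i f := rfl

theorem rename_swap_rename_swap (i : ℕ) (f : MvPolynomial ℕ ℤ) :
    rename (Equiv.swap i (i + 1)) (rename (Equiv.swap i (i + 1)) f) = f := by
  rw [rename_rename, ← Equiv.coe_trans, Equiv.swap_swap]
  exact rename_id_apply f

theorem rename_dividedDiff (i : ℕ) (f : MvPolynomial ℕ ℤ) :
    rename (Equiv.swap i (i + 1)) (dividedDiff i f) = dividedDiff i f := by
  have h := congrArg (rename (Equiv.swap i (i + 1))) (dividedDiff_spec i f)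
  simp only [map_sub, map_mul, rename_X, Equiv.swap_apply_left, Equiv.swap_apply_right,
    rename_swap_rename_swap] at h
  apply mul_left_cancel₀ (X_sub_X_ne_zero (i := i) (j := i + 1) (by omega))
  linear_combination h + dividedDiff_spec i f

theorem dividedDiff_dividedDiff (i : ℕ) (f : MvPolynomial ℕ ℤ) :
    dividedDiff i (dividedDiff i f) = 0 :=
  dividedDiff_eq_zero (rename_dividedDiff i f)

/-- The twisted Leibniz rule for multiplication by a variable. -/
theorem dividedDiff_X_mul (i k : ℕ) (f : MvPolynomial ℕ ℤ) :
    dividedDiff i (X k * f) =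
      ((if k = i then 1 else 0) - (if k = i + 1 then 1 else 0) : ℤ) • f +
        X (Equiv.swap i (i + 1) k) * dividedDiff i f := by
  apply dividedDiff_eq
  have h := dividedDiff_spec i f
  rw [map_mul, rename_X]
  by_cases h1 : k = i
  · subst h1
    simp
    linear_combination X (k + 1) * h
  · by_cases h2 : k = i + 1
    · subst h2
      simp
      linear_combination X i * h
    · simp [h1, h2, Equiv.swap_apply_of_ne_of_ne h1 h2]
      linear_combination X k * h

theorem dividedDiff_X_mul_self {i : ℕ} {f : MvPolynomial ℕ ℤ}
    (h : rename (Equiv.swap i (i + 1)) f = f) : dividedDiff i (X i * f) = f := by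
  rw [dividedDiff_X_mul, dividedDiff_eq_zero h]
  simp

theorem rename_comp_comm {s t : ℕ → ℕ} (h : ∀ x, s (t x) = t (s x)) (f : MvPolynomial ℕ ℤ) :
    rename s (rename t f) = rename t (rename s f) := by
  rw [rename_rename, rename_rename]
  congr 1
  congr 1
  exact funext h

theorem dividedDiff_comm {i j : ℕ} (hij : i + 1 < j) (f : MvPolynomial ℕ ℤ) :
    dividedDiff i (dividedDiff j f) = dividedDiff j (dividedDiff i f) := by
  have hs : ∀ x, Equiv.swap i (i + 1) (Equiv.swap j (j + 1) x) =
      Equiv.swap j (j + 1) (Equiv.swap i (i + 1) x) := by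
    intro x
    simp only [Equiv.swap_apply_def]
    split_ifs <;> omega
  have hc := rename_comp_comm hs f
  have hi := dividedDiff_spec i f
  have hj := dividedDiff_spec j f
  have hij' := dividedDiff_spec i (dividedDiff j f)
  have hji := dividedDiff_spec j (dividedDiff i f)
  have h1 := congrArg (rename (Equiv.swap i (i + 1))) hj
  have h2 := congrArg (rename (Equiv.swap j (j + 1))) hi
  simp only [map_sub, map_mul, rename_X] at h1 h2
  rw [Equiv.swap_apply_of_ne_of_ne (by omega) (by omega),
    Equiv.swap_apply_of_ne_of_ne (by omega) (by omega)] at h1 h2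
  apply mul_left_cancel₀ (mul_ne_zero (X_sub_X_ne_zero (i := i) (j := i + 1) (by omega))
    (X_sub_X_ne_zero (i := j) (j := j + 1) (by omega)))
  linear_combination -((X j - X (j + 1)) * hij') + (X i - X (i + 1)) * hji + h1 - h2 - hj + hi + hc

theorem dividedDiff_braid (i : ℕ) (f : MvPolynomial ℕ ℤ) :
    dividedDiff i (dividedDiff (i + 1) (dividedDiff i f)) =
      dividedDiff (i + 1) (dividedDiff i (dividedDiff (i + 1) f)) := by
  -- after multiplication by the Vandermonde product of `x_i, x_{i+1}, x_{i+2}` both sides become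
  -- the antisymmetrization of `f` over the permutations of the three variables
  set s : ℕ → ℕ := ⇑(Equiv.swap i (i + 1)) with hs
  set t : ℕ → ℕ := ⇑(Equiv.swap (i + 1) (i + 1 + 1)) with ht
  have hbraid : rename s (rename t (rename s f)) = rename t (rename s (rename t f)) := by
    simp only [rename_rename]
    congr 1
    congr 1
    funext x
    simp only [Function.comp, hs, ht, Equiv.swap_apply_def]
    split_ifs <;> omega
  have s0 : s i = i + 1 := Equiv.swap_apply_left ..
  have s1 : s (i + 1) = i := Equiv.swap_apply_right ..
  have s2 : s (i + 1 + 1) = i + 1 + 1 := Equiv.swap_apply_of_ne_of_ne (by omega) (by omega)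
  have t0 : t i = i := Equiv.swap_apply_of_ne_of_ne (by omega) (by omega)
  have t1 : t (i + 1) = i + 1 + 1 := Equiv.swap_apply_left ..
  have t2 : t (i + 1 + 1) = i + 1 := Equiv.swap_apply_right ..
  have a1 := dividedDiff_spec i f
  have a2 := dividedDiff_spec (i + 1) (dividedDiff i f)
  have a3 := dividedDiff_spec i (dividedDiff (i + 1) (dividedDiff i f))
  have b1 := dividedDiff_spec (i + 1) f
  have b2 := dividedDiff_spec i (dividedDiff (i + 1) f)
  have b3 := dividedDiff_spec (i + 1) (dividedDiff i (dividedDiff (i + 1) f))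
  rw [← hs] at a1 a3 b2
  rw [← ht] at a2 b1 b3
  have a1t := congrArg (rename t) a1
  have a1st := congrArg (rename s) a1t
  have a2s := congrArg (rename s) a2
  have b1s := congrArg (rename s) b1
  have b1ts := congrArg (rename t) b1s
  have b2t := congrArg (rename t) b2
  have ess : rename s (rename s f) = f := rename_swap_rename_swap i f
  have ett : rename t (rename t f) = f := rename_swap_rename_swap (i + 1) f
  have esg : rename s (dividedDiff i f) = dividedDiff i f := rename_dividedDiff i f
  have etg : rename t (dividedDiff (i + 1) f) = dividedDiff (i + 1) f :=
    rename_dividedDiff (i + 1) f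
  simp only [map_sub, map_mul, rename_X, s0, s1, s2, t0, t1, t2, ess, ett, esg, etg] at *
  have V : (X i - X (i + 1) : MvPolynomial ℕ ℤ) * ((X (i + 1) - X (i + 1 + 1)) *
      (X i - X (i + 1 + 1))) ≠ 0 :=
    mul_ne_zero (X_sub_X_ne_zero (by omega))
      (mul_ne_zero (X_sub_X_ne_zero (by omega)) (X_sub_X_ne_zero (by omega)))
  have A : (X i - X (i + 1) : MvPolynomial ℕ ℤ) * ((X (i + 1) - X (i + 1 + 1)) *
      (X i - X (i + 1 + 1))) * dividedDiff i (dividedDiff (i + 1) (dividedDiff i f)) =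
      f - rename s f - rename t f + rename t (rename s f) + rename s (rename t f)
        - rename s (rename t (rename s f)) := by
    linear_combination -((X (i + 1) - X (i + 1 + 1)) * (X i - X (i + 1 + 1)) * a3)
      - (X i - X (i + 1 + 1)) * a2 + (X (i + 1) - X (i + 1 + 1)) * a2s - a1 + a1t - a1st
  have B : (X i - X (i + 1) : MvPolynomial ℕ ℤ) * ((X (i + 1) - X (i + 1 + 1)) *
      (X i - X (i + 1 + 1))) *
        dividedDiff (i + 1) (dividedDiff i (dividedDiff (i + 1) f)) =
      f - rename s f - rename t f + rename t (rename s f) + rename s (rename t f)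
        - rename t (rename s (rename t f)) := by
    linear_combination -((X i - X (i + 1)) * (X i - X (i + 1 + 1)) * b3)
      - (X i - X (i + 1 + 1)) * b2 + (X i - X (i + 1)) * b2t - b1 + b1s - b1ts
  apply mul_left_cancel₀ V
  rw [A, B, hbraid]

theorem homogeneousComponent_X_mul (d k : ℕ) (g : MvPolynomial ℕ ℤ) :
    homogeneousComponent (d + 1) (X k * g) = X k * homogeneousComponent d g := by
  induction g using MvPolynomial.induction_on' with
  | monomial m c =>
    have h1 : (monomial m c : MvPolynomial ℕ ℤ).IsHomogeneous m.degree :=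
      isHomogeneous_monomial c rfl
    have h2 : (X k * monomial m c : MvPolynomial ℕ ℤ).IsHomogeneous (1 + m.degree) :=
      (isHomogeneous_X ℤ k).mul h1
    rw [homogeneousComponent_of_mem h1, homogeneousComponent_of_mem h2]
    by_cases h : d = m.degree
    · rw [if_pos (by omega), if_pos (by omega)]
    · rw [if_neg (by omega), if_neg (by omega), mul_zero]
  | add p q hp hq => rw [mul_add, map_add, map_add, hp, hq, mul_add]

theorem isHomogeneous_dividedDiff {i d : ℕ} {f : MvPolynomial ℕ ℤ}
    (hf : f.IsHomogeneous (d + 1)) : (dividedDiff i f).IsHomogeneous d := by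
  have h : dividedDiff i f = homogeneousComponent d (dividedDiff i f) := by
    apply dividedDiff_eq
    rw [sub_mul, ← homogeneousComponent_X_mul, ← homogeneousComponent_X_mul, ← map_sub, ← sub_mul,
      ← dividedDiff_spec, homogeneousComponent_eq_self]
    exact hf.sub hf.rename_isHomogeneous
  rw [h]
  exact homogeneousComponent_isHomogeneous d _

/-- A polynomial that is symmetric under all `s_i` is constant, as it has finitely many
variables. -/
theorem eq_C_of_dividedDiff_eq_zero {f : MvPolynomial ℕ ℤ} (h : ∀ i, dividedDiff i f = 0) :
    f = C (f.coeff 0) := by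
  rw [← vars_eq_empty_iff_eq_C]
  by_contra hne
  obtain ⟨m, hm, hmax⟩ := f.vars.exists_max_image id (Finset.nonempty_iff_ne_empty.mpr hne)
  have h1 : m ∈ (rename (Equiv.swap m (m + 1)) f).vars := by
    rwa [rename_eq_of_dividedDiff_eq_zero (h m)]
  obtain ⟨j, hj, hjm⟩ := mem_vars_rename _ _ h1
  have h2 : j = m + 1 := by
    rw [← SInf.swap_swap m (m + 1) j, hjm, Equiv.swap_apply_left]
  have := hmax j hj
  simp only [id] at this
  omega

end DividedDifferences

/-! ### The recursion defining Schubert polynomials -/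

namespace SInf

open MvPolynomial

theorem Fixes.length_lt_of_ascent {n : ℕ} {w : SInf} (h : Fixes n w) {i : ℕ} (hi : i + 1 < n)
    (hw : w.1 i < w.1 (i + 1)) : w.length < n.choose 2 := by
  have h1 := (h.mul_transp (a := i) (b := i + 1) (by omega) hi).length_le
  rw [length_mul_succ hw] at h1
  omega

theorem decreasing_of_forall_descent {n : ℕ} {w : SInf}
    (h : ¬ ∃ i, i + 1 < n ∧ w.1 i < w.1 (i + 1)) {a b : ℕ} (hab : a < b) (hb : b < n) :
    w.1 b < w.1 a := by
  induction b, hab using Nat.le_induction with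
  | base =>
    change w.1 (a + 1) < w.1 a
    by_contra hc
    have := apply_ne w (a := a) (b := a + 1) (by omega)
    exact h ⟨a, hb, by omega⟩
  | succ b hab ih =>
    have h1 := ih (by omega)
    have : w.1 (b + 1) < w.1 b := by
      by_contra hc
      have := apply_ne w (a := b) (b := b + 1) (by omega)
      exact h ⟨b, hb, by omega⟩
    omega

/-- The recursion does not depend on the bound for the number of steps, once that is large enough
to reach the longest element. -/
theorem schubertAux_eq {n m m' : ℕ} {w : SInf} (hw : Fixes n w)
    (hm : n.choose 2 ≤ m + w.length) (hm' : n.choose 2 ≤ m' + w.length) :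
    schubertAux n m w = schubertAux n m' w := by
  induction m generalizing m' w with
  | zero =>
    have h : ¬ ∃ i, i + 1 < n ∧ w.1 i < w.1 (i + 1) := by
      rintro ⟨i, hi, hwi⟩
      have := hw.length_lt_of_ascent hi hwi
      omega
    cases m' with
    | zero => rfl
    | succ m' => rw [schubertAux, schubertAux, dif_neg h]
  | succ m ih =>
    by_cases h : ∃ i, i + 1 < n ∧ w.1 i < w.1 (i + 1)
    · cases m' with
      | zero =>
        obtain ⟨i, hi, hwi⟩ := h
        have := hw.length_lt_of_ascent hi hwi
        omega
      | succ m' =>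
        classical
        rw [schubertAux, schubertAux, dif_pos h, dif_pos h]
        have hs := Nat.find_spec h
        have hl := length_mul_succ hs.2
        congr 1
        exact ih (hw.mul_transp (by omega) hs.1) (by omega) (by omega)
    · rw [schubertAux, dif_neg h]
      cases m' with
      | zero => rw [schubertAux]
      | succ m' => rw [schubertAux, dif_neg h]

/-- The polynomial of `w` computed inside `𝒮_n`. -/
noncomputable def schubertIn (n : ℕ) (w : SInf) : MvPolynomial ℕ ℤ :=
  schubertAux n (n.choose 2) w

theorem schubertIn_of_no_ascent {n : ℕ} {w : SInf}
    (h : ¬ ∃ i, i + 1 < n ∧ w.1 i < w.1 (i + 1)) : schubertIn n w = staircase n := by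
  rw [schubertIn]
  cases n.choose 2 with
  | zero => rw [schubertAux]
  | succ m => rw [schubertAux, dif_neg h]

open Classical in
theorem schubertIn_find {n : ℕ} {w : SInf} (hw : Fixes n w)
    (h : ∃ i, i + 1 < n ∧ w.1 i < w.1 (i + 1)) :
    schubertIn n w =
      dividedDiff (Nat.find h) (schubertIn n (w * transp (Nat.find h) (Nat.find h + 1))) := by
  have hs := Nat.find_spec h
  have hlt := hw.length_lt_of_ascent hs.1 hs.2
  have hl := length_mul_succ hs.2
  obtain ⟨c, hc⟩ : ∃ c, n.choose 2 = c + 1 := ⟨n.choose 2 - 1, by omega⟩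
  rw [schubertIn, hc, schubertAux, dif_pos h, schubertIn]
  congr 1
  exact schubertAux_eq (hw.mul_transp (by omega) hs.1) (by omega) (by omega)

theorem mul_transp_comm {i j : ℕ} (hij : i + 1 < j) (w : SInf) :
    w * transp i (i + 1) * transp j (j + 1) = w * transp j (j + 1) * transp i (i + 1) := by
  apply ext_apply
  intro x
  simp only [mul_transp_apply]
  congr 1
  simp only [Equiv.swap_apply_def]
  split_ifs <;> omega

theorem mul_transp_braid (i : ℕ) (w : SInf) :
    w * transp i (i + 1) * transp (i + 1) (i + 1 + 1) * transp i (i + 1) =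
      w * transp (i + 1) (i + 1 + 1) * transp i (i + 1) * transp (i + 1) (i + 1 + 1) := by
  apply ext_apply
  intro x
  simp only [mul_transp_apply]
  congr 1
  simp only [Equiv.swap_apply_def]
  split_ifs <;> omega

/-- The recursion may use any ascent instead of the first one. Two ascents lead to a common
permutation above both by a commutation or a braid move, and the divided differences satisfy the
same relations. -/
theorem schubertIn_of_ascent {n : ℕ} {w : SInf} (hw : Fixes n w) {i : ℕ} (hi : i + 1 < n)
    (hwi : w.1 i < w.1 (i + 1)) :
    schubertIn n w = dividedDiff i (schubertIn n (w * transp i (i + 1))) := by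
  induction hd : n.choose 2 - w.length using Nat.strong_induction_on generalizing w i with
  | _ d ih =>
    subst hd
    -- two ascents `i < j` give the same result
    have key : ∀ i j, i < j → j + 1 < n → w.1 i < w.1 (i + 1) → w.1 j < w.1 (j + 1) →
        dividedDiff i (schubertIn n (w * transp i (i + 1))) =
          dividedDiff j (schubertIn n (w * transp j (j + 1))) := by
      intro i j hij hj hwi hwj
      have li := length_mul_succ hwi
      have lj := length_mul_succ hwj
      have fi := hw.mul_transp (a := i) (b := i + 1) (by omega) (by omega)
      have fj := hw.mul_transp (a := j) (b := j + 1) (by omega) (by omega)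
      have bi := fi.length_le
      have bj := fj.length_le
      rcases Nat.lt_or_ge (i + 1) j with hij' | hij'
      · rw [ih _ (by omega) fi (i := j) hj (by
            rwa [mul_transp_of_ne _ (by omega) (by omega),
              mul_transp_of_ne _ (by omega) (by omega)]) rfl,
          ih _ (by omega) fj (i := i) (by omega) (by
            rwa [mul_transp_of_ne _ (by omega) (by omega),
              mul_transp_of_ne _ (by omega) (by omega)]) rfl,
          dividedDiff_comm hij', mul_transp_comm hij']
      · obtain rfl : j = i + 1 := by omega
        set u := w * transp i (i + 1) with hu
        set v := w * transp (i + 1) (i + 1 + 1) with hv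
        have u0 : u.1 i = w.1 (i + 1) := mul_transp_left ..
        have u1 : u.1 (i + 1) = w.1 i := mul_transp_right ..
        have u2 : u.1 (i + 1 + 1) = w.1 (i + 1 + 1) := mul_transp_of_ne _ (by omega) (by omega)
        have v0 : v.1 i = w.1 i := mul_transp_of_ne _ (by omega) (by omega)
        have v1 : v.1 (i + 1) = w.1 (i + 1 + 1) := mul_transp_left ..
        have v2 : v.1 (i + 1 + 1) = w.1 (i + 1) := mul_transp_right ..
        have hu1 : u.1 (i + 1) < u.1 (i + 1 + 1) := by omega
        have hv1 : v.1 i < v.1 (i + 1) := by omega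
        have lu := length_mul_succ hu1
        have lv := length_mul_succ hv1
        have fu := fi.mul_transp (a := i + 1) (b := i + 1 + 1) (by omega) (by omega)
        have fv := fj.mul_transp (a := i) (b := i + 1) (by omega) (by omega)
        have bu := fu.length_le
        have bv := fv.length_le
        rw [ih _ (by omega) fi (i := i + 1) hj hu1 rfl, ih _ (by omega) fj (i := i) (by omega) hv1 rfl]
        set x := u * transp (i + 1) (i + 1 + 1) with hx
        set y := v * transp i (i + 1) with hy
        have x0 : x.1 i = u.1 i := mul_transp_of_ne _ (by omega) (by omega)
        have x1 : x.1 (i + 1) = u.1 (i + 1 + 1) := mul_transp_left ..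
        have y1 : y.1 (i + 1) = v.1 i := mul_transp_right ..
        have y2 : y.1 (i + 1 + 1) = v.1 (i + 1 + 1) := mul_transp_of_ne _ (by omega) (by omega)
        rw [ih _ (by omega) fu (i := i) (by omega) (by omega) rfl,
          ih _ (by omega) fv (i := i + 1) hj (by omega) rfl, dividedDiff_braid, hx, hu,
          mul_transp_braid]
    classical
    have h : ∃ i, i + 1 < n ∧ w.1 i < w.1 (i + 1) := ⟨i, hi, hwi⟩
    rw [schubertIn_find hw h]
    have hs := Nat.find_spec h
    rcases (Nat.find_min' h ⟨hi, hwi⟩).lt_or_eq with hlt | heq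
    · exact key _ _ hlt hi hs.2 hwi
    · rw [heq]

theorem staircase_succ (n : ℕ) :
    staircase (n + 1) = staircase n * ∏ i ∈ Finset.range n, X i := by
  rw [staircase, staircase, Finset.prod_range_succ, ← Finset.prod_mul_distrib]
  simp only [add_tsub_cancel_right, tsub_self, pow_zero, mul_one]
  refine Finset.prod_congr rfl fun i hi => ?_
  rw [← pow_succ]
  congr 1
  have := Finset.mem_range.mp hi
  omega

theorem rename_staircase_mul {n j : ℕ} (hj : j < n) :
    rename (Equiv.swap j (j + 1)) (staircase n * ∏ i ∈ Finset.Ico (j + 1) n, X i) =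
      staircase n * ∏ i ∈ Finset.Ico (j + 1) n, X i := by
  have h : (staircase n * ∏ i ∈ Finset.Ico (j + 1) n, X i : MvPolynomial ℕ ℤ) =
      ∏ i ∈ Finset.range (n + 1), X i ^ (n - 1 - i + if j + 1 ≤ i ∧ i < n then 1 else 0) := by
    simp only [pow_add, Finset.prod_mul_distrib]
    congr 1
    · rw [staircase, Finset.prod_range_succ, show n - 1 - n = 0 by omega, pow_zero, mul_one]
    · rw [← Finset.prod_filter_mul_prod_filter_not (Finset.range (n + 1))
        (fun i => j + 1 ≤ i ∧ i < n)]
      rw [Finset.prod_congr (s₁ := Finset.filter _ _) rfl (g := fun i => X i) (fun i hi => by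
          rw [if_pos (Finset.mem_filter.mp hi).2, pow_one]),
        Finset.prod_congr (s₁ := Finset.filter (fun i => ¬ _) _) rfl (g := fun i => 1)
          (fun i hi => by
          rw [if_neg (Finset.mem_filter.mp hi).2, pow_zero]), Finset.prod_const_one, mul_one]
      refine Finset.prod_congr ?_ fun _ _ => rfl
      ext i
      simp only [Finset.mem_Ico, Finset.mem_filter, Finset.mem_range]
      omega
  rw [h, map_prod]
  refine Finset.prod_bij (fun i _ => Equiv.swap j (j + 1) i) ?_ ?_ ?_ ?_
  · intro i hi
    rw [Finset.mem_range] at hi ⊢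
    simp only [Equiv.swap_apply_def]
    split_ifs <;> omega
  · intro a _ b _ hab
    exact (Equiv.swap j (j + 1)).injective hab
  · intro b hb
    refine ⟨Equiv.swap j (j + 1) b, ?_, swap_swap ..⟩
    rw [Finset.mem_range] at hb ⊢
    simp only [Equiv.swap_apply_def]
    split_ifs <;> omega
  · intro i hi
    rw [map_pow, rename_X]
    congr 1
    -- the exponents of `x_j` and `x_{j+1}` are both `n - 1 - j`
    rw [Finset.mem_range] at hi
    simp only [Equiv.swap_apply_def]
    split_ifs <;> omega

/-- The permutation of `𝒮_{n+1}` whose largest value `n` is at position `j` and which is decreasing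
elsewhere: its polynomial interpolates between the staircase monomials of `n + 1` (for `j = 0`)
and `n` (for `j = n`). -/
theorem schubertIn_almost_decreasing {n j : ℕ} (hj : j ≤ n) {v : SInf} (hv : Fixes (n + 1) v)
    (hvj : v.1 j = n) (hdec : ∀ a b, a < b → b ≤ n → a ≠ j → b ≠ j → v.1 b < v.1 a) :
    schubertIn (n + 1) v = staircase n * ∏ i ∈ Finset.Ico j n, X i := by
  have hlt : ∀ a, a ≤ n → a ≠ j → v.1 a < n := fun a ha haj => by
    have h1 := hv.apply_lt (i := a) (by omega)
    have h2 := apply_ne v haj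
    omega
  induction j generalizing v with
  | zero =>
    rw [schubertIn_of_no_ascent, staircase_succ, Finset.range_eq_Ico]
    rintro ⟨i, hi, hvi⟩
    rcases Nat.eq_zero_or_pos i with rfl | hi0
    · have := hlt 1 (by omega) (by omega)
      simp only [zero_add] at hvi
      omega
    · have := hdec i (i + 1) (by omega) (by omega) (by omega) (by omega)
      omega
  | succ j ih =>
    have hasc : v.1 j < v.1 (j + 1) := by rw [hvj]; exact hlt j (by omega) (by omega)
    have hf := hv.mul_transp (a := j) (b := j + 1) (by omega) (by omega)
    have hj' : (v * transp j (j + 1)).1 j = n := by rw [mul_transp_left, hvj]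
    rw [schubertIn_of_ascent hv (by omega) hasc, ih (by omega) hf hj',
      Finset.prod_eq_prod_Ico_succ_bot (by omega), mul_left_comm,
      dividedDiff_X_mul_self (rename_staircase_mul (by omega))]
    · intro a b hab hb haj hbj
      rw [mul_transp_apply, mul_transp_apply]
      refine hdec _ _ (swap_succ_lt hab (by omega)) ?_ ?_ ?_ <;>
      · simp only [Equiv.swap_apply_def]
        split_ifs <;> omega
    · intro a ha haj
      have h1 := hf.apply_lt (i := a) (by omega)
      have h2 := apply_ne (v * transp j (j + 1)) haj
      omega

/-- Stability: the polynomial of `w` does not depend on the finite symmetric group. -/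
theorem schubertIn_succ {n : ℕ} {w : SInf} (hw : Fixes n w) :
    schubertIn (n + 1) w = schubertIn n w := by
  induction hd : n.choose 2 - w.length using Nat.strong_induction_on generalizing w with
  | _ d ih =>
    subst hd
    by_cases h : ∃ i, i + 1 < n ∧ w.1 i < w.1 (i + 1)
    · obtain ⟨i, hi, hwi⟩ := h
      have hf := hw.mul_transp (a := i) (b := i + 1) (by omega) hi
      have h1 := length_mul_succ hwi
      have h2 := hf.length_le
      rw [schubertIn_of_ascent hw hi hwi,
        schubertIn_of_ascent (hw.mono (Nat.le_succ n)) (by omega) hwi, ih _ (by omega) hf rfl]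
    · rw [schubertIn_of_no_ascent h, schubertIn_almost_decreasing le_rfl (hw.mono (Nat.le_succ n))
        (hw n le_rfl), Finset.Ico_self, Finset.prod_empty, mul_one]
      intro a b hab hb _ hbn
      exact decreasing_of_forall_descent h hab (by omega)

theorem schubertIn_eq {n : ℕ} {w : SInf} (hw : Fixes n w) : schubertIn n w = schubert w := by
  have hr : w.rank ≤ n := Nat.sInf_le hw
  induction n, hr using Nat.le_induction with
  | base => rfl
  | succ n hn ih =>
    have hf := (fixes_rank w).mono hn
    rw [schubertIn_succ hf, ih hf]

theorem dividedDiff_schubert_of_descent {w : SInf} {i : ℕ} (h : w.1 (i + 1) < w.1 i) :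
    dividedDiff i (schubert w) = schubert (w * transp i (i + 1)) := by
  obtain ⟨m, hm⟩ := exists_fixes w
  have hw := hm.mono (le_max_left m (i + 2))
  have hi : i + 1 < max m (i + 2) := by omega
  have hf := hw.mul_transp (a := i) (b := i + 1) (by omega) hi
  rw [← schubertIn_eq hw, ← schubertIn_eq hf, schubertIn_of_ascent hf hi, mul_transp_cancel]
  rwa [mul_transp_left, mul_transp_right]

theorem dividedDiff_schubert_of_ascent {w : SInf} {i : ℕ} (h : w.1 i < w.1 (i + 1)) :
    dividedDiff i (schubert w) = 0 := by
  have h1 := dividedDiff_schubert_of_descent (w := w * transp i (i + 1)) (i := i)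
    (by rwa [mul_transp_left, mul_transp_right])
  rw [mul_transp_cancel] at h1
  rw [← h1, dividedDiff_dividedDiff]

theorem schubert_one : schubert 1 = 1 := by
  rw [← schubertIn_eq (fixes_one 0), schubertIn_of_no_ascent (by rintro ⟨i, hi, -⟩; omega),
    staircase, Finset.prod_range_zero]

theorem isHomogeneous_staircase (n : ℕ) : (staircase n).IsHomogeneous (n.choose 2) := by
  have h : n.choose 2 = ∑ i ∈ Finset.range n, (n - 1 - i) := by
    rw [Finset.sum_range_reflect (fun i => i), Finset.sum_range_id, Nat.choose_two_right]
  rw [h]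
  exact IsHomogeneous.prod _ _ _ fun i _ => isHomogeneous_X_pow i _

theorem isHomogeneous_schubert (w : SInf) : (schubert w).IsHomogeneous w.length := by
  obtain ⟨n, hw⟩ := exists_fixes w
  rw [← schubertIn_eq hw]
  induction hd : n.choose 2 - w.length using Nat.strong_induction_on generalizing w with
  | _ d ih =>
    subst hd
    by_cases h : ∃ i, i + 1 < n ∧ w.1 i < w.1 (i + 1)
    · obtain ⟨i, hi, hwi⟩ := h
      have hf := hw.mul_transp (a := i) (b := i + 1) (by omega) hi
      have h1 := length_mul_succ hwi
      have h2 := hf.length_le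
      rw [schubertIn_of_ascent hw hi hwi]
      apply isHomogeneous_dividedDiff
      rw [← h1]
      exact ih _ (by omega) _ hf rfl
    · rw [schubertIn_of_no_ascent h,
        hw.length_eq fun a b hab hb => decreasing_of_forall_descent h hab hb]
      exact isHomogeneous_staircase n

end SInf

/-! ### Multiplication by a variable -/

namespace SInf

open MvPolynomial

open Classical in
/-- The term of `x_k 𝔖_w` indexed by `j`: it is `±𝔖_{w (k, j)}` if `w ⋖ w (k, j)`, with sign `+` if
`k < j` and `-` if `j < k`, and `0` otherwise (in particular if `j = k`). -/
noncomputable def monkTerm (k : ℕ) (w : SInf) (j : ℕ) : MvPolynomial ℕ ℤ :=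
  if w.length + 1 = (w * transp k j).length then
    (if k < j then schubert (w * transp k j) else -schubert (w * transp k j)) else 0

theorem monkTerm_of_lt {k j : ℕ} {w : SInf} (h : w.length + 1 = (w * transp k j).length)
    (hkj : k < j) : monkTerm k w j = schubert (w * transp k j) := by
  rw [monkTerm, if_pos h, if_pos hkj]

theorem monkTerm_of_gt {k j : ℕ} {w : SInf} (h : w.length + 1 = (w * transp k j).length)
    (hkj : j < k) : monkTerm k w j = -schubert (w * transp k j) := by
  rw [monkTerm, if_pos h, if_neg (by omega)]

theorem monkTerm_of_not {k j : ℕ} {w : SInf} (h : ¬ w.length + 1 = (w * transp k j).length) :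
    monkTerm k w j = 0 := by
  rw [monkTerm, if_neg h]

theorem ne_of_cover {k j : ℕ} {w : SInf} (h : w.length + 1 = (w * transp k j).length) : k ≠ j := by
  rintro rfl
  have : w * transp k k = w := by
    apply ext_apply
    intro i
    rw [mul_transp_apply, Equiv.swap_self]
    rfl
  rw [this] at h
  omega

theorem monkTerm_antisymm (k : ℕ) (w : SInf) (j : ℕ) : monkTerm k w j = -monkTerm j w k := by
  have hc : w * transp k j = w * transp j k := by rw [transp_comm]
  by_cases h : w.length + 1 = (w * transp k j).length
  · rcases lt_or_gt_of_ne (ne_of_cover h) with h1 | h1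
    · rw [monkTerm_of_lt h h1, monkTerm_of_gt (hc ▸ h) h1, neg_neg, hc]
    · rw [monkTerm_of_gt h h1, monkTerm_of_lt (hc ▸ h) h1, hc]
  · rw [monkTerm_of_not h, monkTerm_of_not (hc ▸ h), neg_zero]

/-- Only finitely many positions contribute to `x_k 𝔖_w`: a fixed point `c > k` blocks all covers
`w ⋖ w (k, j)` with `j > c`. -/
theorem monkTerm_eq_zero {n k j : ℕ} {w : SInf} (hw : Fixes n w) (hk : k < n) (hj : n < j) :
    monkTerm k w j = 0 := by
  refine monkTerm_of_not fun h => ?_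
  refine not_between_of_cover (c := n) (by omega) hj h ?_
  rw [hw n le_rfl, hw j hj.le]
  exact ⟨hw.apply_lt hk, hj⟩

theorem finite_support_monkTerm (k : ℕ) (w : SInf) : (Function.support (monkTerm k w)).Finite := by
  obtain ⟨m, hm⟩ := exists_fixes w
  refine (Set.finite_Iic (max m (k + 1))).subset fun j hj => ?_
  by_contra hc
  refine hj (monkTerm_eq_zero (hm.mono (le_max_left m (k + 1))) (by omega) ?_)
  simpa using hc

theorem isHomogeneous_monkTerm (k : ℕ) (w : SInf) (j : ℕ) :
    (monkTerm k w j).IsHomogeneous (w.length + 1) := by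
  rw [monkTerm]
  split_ifs with h1 h2
  · rw [h1]; exact isHomogeneous_schubert _
  · rw [h1]; exact (isHomogeneous_schubert _).neg
  · exact isHomogeneous_zero ..

/-- The part of `∂_i (x_k 𝔖_w)` coming from `∂_i x_k`, at the one position `s_i k`. -/
noncomputable def leibnizTerm (i k : ℕ) (w : SInf) (j : ℕ) : MvPolynomial ℕ ℤ :=
  if j = Equiv.swap i (i + 1) k then
    ((if k = i then 1 else 0) - (if k = i + 1 then 1 else 0) : ℤ) • schubert w else 0

theorem leibnizTerm_left (i : ℕ) (w : SInf) : leibnizTerm i i w (i + 1) = schubert w := by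
  simp [leibnizTerm]

theorem leibnizTerm_right (i : ℕ) (w : SInf) : leibnizTerm i (i + 1) w i = -schubert w := by
  simp [leibnizTerm]

theorem leibnizTerm_of_ne {i k j : ℕ} {w : SInf} (h1 : ¬ (k = i ∧ j = i + 1))
    (h2 : ¬ (k = i + 1 ∧ j = i)) : leibnizTerm i k w j = 0 := by
  rw [leibnizTerm]
  split_ifs with h <;> subst_vars <;> simp_all [Equiv.swap_apply_def]

theorem finsum_leibnizTerm (i k : ℕ) (w : SInf) :
    ∑ᶠ j, leibnizTerm i k w j =
      ((if k = i then 1 else 0) - (if k = i + 1 then 1 else 0) : ℤ) • schubert w := by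
  rw [finsum_eq_single _ (Equiv.swap i (i + 1) k) fun j hj => by rw [leibnizTerm, if_neg hj],
    leibnizTerm, if_pos rfl]

theorem finite_support_leibnizTerm (i k : ℕ) (w : SInf) :
    (Function.support (leibnizTerm i k w)).Finite := by
  refine (Set.finite_singleton (Equiv.swap i (i + 1) k)).subset fun j hj => ?_
  by_contra hc
  exact hj (if_neg hc)

theorem eq_of_cover_of_descent' {k j i : ℕ} {w : SInf}
    (h : w.length + 1 = (w * transp k j).length) (hi : w.1 i < w.1 (i + 1))
    (hd : (w * transp k j).1 (i + 1) < (w * transp k j).1 i) :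
    (k = i ∧ j = i + 1) ∨ (k = i + 1 ∧ j = i) := by
  rcases lt_or_gt_of_ne (ne_of_cover h) with h1 | h1
  · exact Or.inl (eq_of_cover_of_descent h1 h hi hd)
  · rw [transp_comm] at h hd
    exact Or.inr (eq_of_cover_of_descent h1 h hi hd).symm

theorem ascent_or_descent (w : SInf) (i : ℕ) : w.1 i < w.1 (i + 1) ∨ w.1 (i + 1) < w.1 i :=
  lt_or_gt_of_ne (apply_ne w (by omega))

theorem dividedDiff_neg (i : ℕ) (f : MvPolynomial ℕ ℤ) : dividedDiff i (-f) = -dividedDiff i f :=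
  map_neg (dividedDiffLin i) f

theorem dividedDiff_zero (i : ℕ) : dividedDiff i 0 = 0 := map_zero (dividedDiffLin i)

theorem dividedDiff_monkTerm_of_ascent {i : ℕ} {w : SInf} (hi : w.1 i < w.1 (i + 1)) (k j : ℕ) :
    dividedDiff i (monkTerm k w j) = leibnizTerm i k w j := by
  by_cases h1 : k = i ∧ j = i + 1
  · obtain ⟨rfl, rfl⟩ := h1
    rw [leibnizTerm_left, monkTerm_of_lt (length_mul_succ hi).symm (by omega),
      dividedDiff_schubert_of_descent, mul_transp_cancel]
    rwa [mul_transp_left, mul_transp_right]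
  by_cases h2 : k = i + 1 ∧ j = i
  · obtain ⟨rfl, rfl⟩ := h2
    rw [leibnizTerm_right, monkTerm_antisymm, monkTerm_of_lt (length_mul_succ hi).symm (by omega),
      dividedDiff_neg, dividedDiff_schubert_of_descent, mul_transp_cancel]
    rwa [mul_transp_left, mul_transp_right]
  rw [leibnizTerm_of_ne h1 h2]
  by_cases h : w.length + 1 = (w * transp k j).length
  · have hd : (w * transp k j).1 i < (w * transp k j).1 (i + 1) := by
      refine (ascent_or_descent _ i).resolve_right fun hd => ?_
      rcases eq_of_cover_of_descent' h hi hd with h3 | h3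
      · exact h1 h3
      · exact h2 h3
    rw [monkTerm, if_pos h]
    split_ifs
    · exact dividedDiff_schubert_of_ascent hd
    · rw [dividedDiff_neg, dividedDiff_schubert_of_ascent hd, neg_zero]
  · rw [monkTerm_of_not h, dividedDiff_zero]

/-- The covers of `w = v s_i` that have a descent at `i` correspond, by conjugation with `s_i`, to
the covers of `v` other than `w` itself. -/
theorem dividedDiff_monkTerm_of_descent {i : ℕ} {w : SInf} (hi : w.1 (i + 1) < w.1 i) (k j : ℕ) :
    dividedDiff i (monkTerm k w j) =
      monkTerm (Equiv.swap i (i + 1) k) (w * transp i (i + 1)) (Equiv.swap i (i + 1) j) +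
        leibnizTerm i k w j := by
  have hl := length_mul_pred hi
  have hv : (w * transp i (i + 1)).1 i < (w * transp i (i + 1)).1 (i + 1) := by
    rwa [mul_transp_left, mul_transp_right]
  have hself : (w * transp i (i + 1)).length + 1 =
      (w * transp i (i + 1) * transp i (i + 1)).length := by
    rw [mul_transp_cancel, hl]
  by_cases h1 : k = i ∧ j = i + 1
  · obtain ⟨rfl, rfl⟩ := h1
    rw [leibnizTerm_left, Equiv.swap_apply_left, Equiv.swap_apply_right, monkTerm_of_not (by omega),
      monkTerm_antisymm, monkTerm_of_lt hself (by omega), mul_transp_cancel, dividedDiff_zero]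
    ring
  by_cases h2 : k = i + 1 ∧ j = i
  · obtain ⟨rfl, rfl⟩ := h2
    rw [leibnizTerm_right, Equiv.swap_apply_left, Equiv.swap_apply_right, monkTerm_antisymm,
      monkTerm_of_not (by omega), monkTerm_of_lt hself (by omega), mul_transp_cancel, neg_zero,
      dividedDiff_zero]
    ring
  rw [leibnizTerm_of_ne h1 h2, add_zero]
  set s := Equiv.swap i (i + 1) with hs
  have hconj : w * transp k j * transp i (i + 1) =
      w * transp i (i + 1) * transp (s k) (s j) := by
    have := mul_transp_conj (w * transp i (i + 1)) i k j
    rwa [mul_transp_cancel] at this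
  have hconj' : w * transp i (i + 1) * transp (s k) (s j) * transp i (i + 1) =
      w * transp k j := by rw [← hconj, mul_transp_cancel]
  by_cases h : (w * transp i (i + 1)).length + 1 =
      (w * transp i (i + 1) * transp (s k) (s j)).length
  · -- then `w (k, j) = v (s_i k, s_i j) s_i` is longer by one and has a descent at `i`
    have hasc := (ascent_or_descent (w * transp i (i + 1) * transp (s k) (s j)) i).resolve_right
      fun hd => by
        rcases eq_of_cover_of_descent' h hv hd with ⟨h3, h4⟩ | ⟨h3, h4⟩
        · refine h2 ⟨?_, ?_⟩
          · rw [← swap_swap i (i + 1) k, ← hs, h3, hs, Equiv.swap_apply_left]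
          · rw [← swap_swap i (i + 1) j, ← hs, h4, hs, Equiv.swap_apply_right]
        · refine h1 ⟨?_, ?_⟩
          · rw [← swap_swap i (i + 1) k, ← hs, h3, hs, Equiv.swap_apply_right]
          · rw [← swap_swap i (i + 1) j, ← hs, h4, hs, Equiv.swap_apply_left]
    have hl2 := length_mul_succ hasc
    rw [hconj'] at hl2
    have hcov : w.length + 1 = (w * transp k j).length := by omega
    have hd : (w * transp k j).1 (i + 1) < (w * transp k j).1 i := by
      rw [← hconj', mul_transp_left, mul_transp_right]
      exact hasc
    rcases lt_or_gt_of_ne (ne_of_cover hcov) with h3 | h3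
    · have h4 : s k < s j := swap_succ_lt h3 h1
      rw [monkTerm_of_lt hcov h3, monkTerm_of_lt h h4, dividedDiff_schubert_of_descent hd, hconj]
    · have h4 : s j < s k := swap_succ_lt h3 fun h => h2 h.symm
      rw [monkTerm_of_gt hcov h3, monkTerm_of_gt h h4, dividedDiff_neg,
        dividedDiff_schubert_of_descent hd, hconj]
  · rw [monkTerm_of_not h]
    by_cases hcov : w.length + 1 = (w * transp k j).length
    · have hasc := (ascent_or_descent (w * transp k j) i).resolve_right fun hd => by
        have hl2 := length_mul_pred hd
        rw [hconj] at hl2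
        omega
      rw [monkTerm, if_pos hcov]
      split_ifs
      · exact dividedDiff_schubert_of_ascent hasc
      · rw [dividedDiff_neg, dividedDiff_schubert_of_ascent hasc, neg_zero]
    · rw [monkTerm_of_not hcov, dividedDiff_zero]

theorem dividedDiff_finsum_monkTerm (i k : ℕ) (w : SInf) :
    dividedDiff i (∑ᶠ j, monkTerm k w j) = ∑ᶠ j, dividedDiff i (monkTerm k w j) :=
  (dividedDiffLin i).toAddMonoidHom.map_finsum (finite_support_monkTerm k w)

/-- Monk's rule for a variable. Both sides are homogeneous of degree `ℓ(w) + 1 > 0`, and by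
induction on `ℓ(w)` they have the same divided differences. -/
theorem X_mul_schubert (k : ℕ) (w : SInf) : X k * schubert w = ∑ᶠ j, monkTerm k w j := by
  induction hd : w.length using Nat.strong_induction_on generalizing w k with
  | _ d ih =>
    subst hd
    have hker : ∀ i, dividedDiff i (X k * schubert w - ∑ᶠ j, monkTerm k w j) = 0 := by
      intro i
      have hsub : dividedDiff i (X k * schubert w - ∑ᶠ j, monkTerm k w j) =
          dividedDiff i (X k * schubert w) - dividedDiff i (∑ᶠ j, monkTerm k w j) :=
        map_sub (dividedDiffLin i) _ _
      rw [hsub, dividedDiff_finsum_monkTerm, dividedDiff_X_mul, sub_eq_zero]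
      rcases ascent_or_descent w i with hi | hi
      · rw [finsum_congr (dividedDiff_monkTerm_of_ascent hi k), finsum_leibnizTerm,
          dividedDiff_schubert_of_ascent hi, mul_zero, add_zero]
      · have hfin : (Function.support fun j => monkTerm (Equiv.swap i (i + 1) k)
            (w * transp i (i + 1)) (Equiv.swap i (i + 1) j)).Finite :=
          (finite_support_monkTerm _ _).preimage (Equiv.injective _).injOn
        rw [finsum_congr (dividedDiff_monkTerm_of_descent hi k),
          finsum_add_distrib hfin (finite_support_leibnizTerm i k w), finsum_leibnizTerm,
          dividedDiff_schubert_of_descent hi, finsum_comp_equiv (Equiv.swap i (i + 1)),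
          ← ih _ (by rw [length_mul_pred hi]; omega) _ _ rfl, add_comm]
    have hhom : (X k * schubert w - ∑ᶠ j, monkTerm k w j).IsHomogeneous (w.length + 1) := by
      refine IsHomogeneous.sub ?_ ?_
      · rw [add_comm]
        exact (isHomogeneous_X ℤ k).mul (isHomogeneous_schubert w)
      · rw [finsum_eq_sum _ (finite_support_monkTerm k w)]
        exact IsHomogeneous.sum _ _ _ fun j _ => isHomogeneous_monkTerm k w j
    have hC := eq_C_of_dividedDiff_eq_zero hker
    rw [hhom.coeff_eq_zero (by simp), C_0] at hC
    exact sub_eq_zero.mp hC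

/-! ### The basis of Schubert polynomials -/

theorem X_mul_schubert_mem_span (s : Set SInf) (k : ℕ) (w : SInf)
    (h : ∀ j, w.length + 1 = (w * transp k j).length → w * transp k j ∈ s) :
    X k * schubert w ∈ Submodule.span ℤ (schubert '' s) := by
  rw [X_mul_schubert, finsum_eq_sum _ (finite_support_monkTerm k w)]
  refine Submodule.sum_mem _ fun j _ => ?_
  rw [monkTerm]
  split_ifs with h1 h2
  · exact Submodule.subset_span ⟨_, h j h1, rfl⟩
  · exact neg_mem (Submodule.subset_span ⟨_, h j h1, rfl⟩)
  · exact zero_mem _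

/-- If a set of permutations is closed under covers, the span of its Schubert polynomials is an
ideal. -/
theorem mul_mem_span {s : Set SInf}
    (hs : ∀ w ∈ s, ∀ k j, w.length + 1 = (w * transp k j).length → w * transp k j ∈ s)
    (p : MvPolynomial ℕ ℤ) {f : MvPolynomial ℕ ℤ} (hf : f ∈ Submodule.span ℤ (schubert '' s)) :
    p * f ∈ Submodule.span ℤ (schubert '' s) := by
  induction p using MvPolynomial.induction_on generalizing f with
  | C a =>
    rw [← smul_eq_C_mul]
    exact Submodule.smul_mem _ _ hf
  | add p q hp hq =>
    rw [add_mul]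
    exact add_mem (hp hf) (hq hf)
  | mul_X p k hp =>
    rw [mul_assoc]
    apply hp
    induction hf using Submodule.span_induction with
    | mem x hx =>
      obtain ⟨w, hw, rfl⟩ := hx
      exact X_mul_schubert_mem_span s k w fun j => hs w hw k j
    | zero => rw [mul_zero]; exact zero_mem _
    | add x y _ _ hx hy => rw [mul_add]; exact add_mem hx hy
    | smul a x _ hx => rw [mul_smul_comm]; exact Submodule.smul_mem _ _ hx

theorem span_schubert : ⊤ ≤ Submodule.span ℤ (Set.range schubert) := by
  intro p _
  rw [← Set.image_univ, ← mul_one p, ← schubert_one]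
  exact mul_mem_span (fun _ _ _ _ _ => Set.mem_univ _) p
    (Submodule.subset_span ⟨1, Set.mem_univ _, rfl⟩)

/-- The divided difference `∂_i` on formal combinations of permutations: `w ↦ w s_i` if `w` has a
descent at `i`, and `w ↦ 0` otherwise. -/
noncomputable def descentOp (i : ℕ) (f : SInf →₀ ℤ) : SInf →₀ ℤ :=
  (f.filter fun w => w.1 (i + 1) < w.1 i).mapDomain (· * transp i (i + 1))

theorem dividedDiff_linearCombination (i : ℕ) (f : SInf →₀ ℤ) :
    dividedDiff i (Finsupp.linearCombination ℤ schubert f) =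
      Finsupp.linearCombination ℤ schubert (descentOp i f) := by
  rw [descentOp, Finsupp.linearCombination_mapDomain, ← dividedDiffLin_apply]
  induction f using Finsupp.induction_linear with
  | zero => rw [Finsupp.filter_zero, map_zero, map_zero, map_zero]
  | add f g hf hg => rw [map_add, map_add, hf, hg, Finsupp.filter_add, map_add]
  | single w a =>
    rw [Finsupp.linearCombination_single, map_smul, dividedDiffLin_apply]
    rcases ascent_or_descent w i with h | h
    · rw [dividedDiff_schubert_of_ascent h, smul_zero, Finsupp.filter_single_of_neg _ (by omega),
        map_zero]
    · rw [dividedDiff_schubert_of_descent h, Finsupp.filter_single_of_pos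
        (fun w : SInf => w.1 (i + 1) < w.1 i) h,
        Finsupp.linearCombination_single]
      rfl

/-- Independence: applying a divided difference shortens all permutations of a relation, and only
multiples of the identity are killed by all of them. -/
theorem linearIndependent_schubert : LinearIndependent ℤ schubert := by
  rw [linearIndependent_iff]
  suffices h : ∀ (n : ℕ) (f : SInf →₀ ℤ), (∀ w ∈ f.support, w.length < n) →
      Finsupp.linearCombination ℤ schubert f = 0 → f = 0 by
    intro f hf
    refine h (f.support.sup length + 1) f (fun w hw => ?_) hf
    exact Nat.lt_succ_of_le (Finset.le_sup hw)
  intro n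
  induction n with
  | zero =>
    intro f hf _
    ext w
    by_contra hw
    exact absurd (hf w (Finsupp.mem_support_iff.mpr hw)) (by omega)
  | succ n ih =>
    intro f hf hS
    have hD : ∀ i, descentOp i f = 0 := by
      intro i
      refine ih _ (fun w hw => ?_) ?_
      · classical
        obtain ⟨v, hv, rfl⟩ := Finset.mem_image.mp (Finsupp.mapDomain_support hw)
        rw [Finsupp.support_filter, Finset.mem_filter] at hv
        have h1 := hf v hv.1
        have h2 := length_mul_pred hv.2
        omega
      · rw [← dividedDiff_linearCombination, hS, dividedDiff_zero]
    have h1 : ∀ w, w ≠ 1 → f w = 0 := by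
      intro w hw
      obtain ⟨i, hi⟩ := exists_descent hw
      have h2 : f.filter (fun w => w.1 (i + 1) < w.1 i) = 0 :=
        Finsupp.mapDomain_injective (mul_left_injective (transp i (i + 1)))
          ((hD i).trans Finsupp.mapDomain_zero.symm)
      rw [← Finsupp.filter_apply_pos (fun w : SInf => w.1 (i + 1) < w.1 i) f hi, h2,
        Finsupp.zero_apply]
    have h3 : f = Finsupp.single 1 (f 1) := by
      ext w
      by_cases hw : w = 1
      · rw [hw, Finsupp.single_eq_same]
      · rw [h1 w hw, Finsupp.single_eq_of_ne hw]
    rw [h3, Finsupp.linearCombination_single, schubert_one, smul_eq_zero] at hS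
    rw [h3, hS.resolve_right one_ne_zero, Finsupp.single_zero]

/-- The basis of Schubert polynomials. -/
noncomputable def schubertBasis : Module.Basis SInf ℤ (MvPolynomial ℕ ℤ) :=
  Module.Basis.mk linearIndependent_schubert span_schubert

theorem schubertBasis_apply (w : SInf) : schubertBasis w = schubert w :=
  Module.Basis.mk_apply ..

theorem structureConst_eq (u v w : SInf) :
    structureConst u v w = schubertBasis.repr (schubert u * schubert v) w := by
  have h : ∃ B : Module.Basis SInf ℤ (MvPolynomial ℕ ℤ), ∀ x, B x = schubert x :=
    ⟨schubertBasis, schubertBasis_apply⟩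
  have h1 : h.choose = schubertBasis :=
    Module.Basis.eq_of_apply_eq fun x => (h.choose_spec x).trans (schubertBasis_apply x).symm
  rw [structureConst, dif_pos h, h1]

theorem repr_schubert (w : SInf) : schubertBasis.repr (schubert w) = Finsupp.single w 1 := by
  rw [← schubertBasis_apply, Module.Basis.repr_self]

end SInf

/-! ### Vanishing of structure constants -/

namespace SInf

open MvPolynomial

theorem Fixes.of_cover' {n k j : ℕ} {w : SInf}
    (h : w.length + 1 = (w * transp k j).length) (hn : Fixes n (w * transp k j)) : Fixes n w := by
  rcases lt_or_gt_of_ne (ne_of_cover h) with h1 | h1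
  · exact (Fixes.of_cover h1 h hn).2
  · rw [transp_comm] at h hn
    exact (Fixes.of_cover h1 h hn).2

/-- If `𝔖_w` occurs in `𝔖_u 𝔖_v` and `w ∈ 𝒮_n`, then `v ∈ 𝒮_n`: the Schubert polynomials of
permutations outside `𝒮_n` span an ideal. -/
theorem fixes_of_structureConst_ne_zero {n : ℕ} {u v w : SInf} (hw : Fixes n w)
    (h : structureConst u v w ≠ 0) : Fixes n v := by
  by_contra hv
  have h1 : schubert u * schubert v ∈ Submodule.span ℤ (schubert '' {x | ¬ Fixes n x}) :=
    mul_mem_span (s := {x | ¬ Fixes n x}) (fun x hx k j hc hn => hx (Fixes.of_cover' hc hn)) _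
      (Submodule.subset_span ⟨v, hv, rfl⟩)
  rw [← funext schubertBasis_apply, Module.Basis.mem_span_image] at h1
  rw [structureConst_eq, ← funext schubertBasis_apply] at h
  exact h1 (Finsupp.mem_support_iff.mpr h) hw

theorem homogeneousComponent_linearCombination (d : ℕ) (f : SInf →₀ ℤ) :
    homogeneousComponent d (Finsupp.linearCombination ℤ schubert f) =
      Finsupp.linearCombination ℤ schubert (f.filter fun w => w.length = d) := by
  induction f using Finsupp.induction_linear with
  | zero => rw [Finsupp.filter_zero, map_zero, map_zero]
  | add f g hf hg => rw [map_add, map_add, hf, hg, Finsupp.filter_add, map_add]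
  | single w a =>
    rw [Finsupp.linearCombination_single, map_smul,
      homogeneousComponent_of_mem (isHomogeneous_schubert w)]
    by_cases h : w.length = d
    · rw [if_pos h.symm, Finsupp.filter_single_of_pos (fun w : SInf => w.length = d) h,
        Finsupp.linearCombination_single]
    · rw [if_neg fun e => h e.symm, Finsupp.filter_single_of_neg (fun w : SInf => w.length = d) h,
        map_zero, smul_zero]

theorem linearCombination_repr (p : MvPolynomial ℕ ℤ) :
    Finsupp.linearCombination ℤ schubert (schubertBasis.repr p) = p := by
  rw [← funext schubertBasis_apply]
  exact schubertBasis.linearCombination_repr p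

theorem length_eq_of_repr_ne_zero {d : ℕ} {p : MvPolynomial ℕ ℤ} (hp : p.IsHomogeneous d)
    {w : SInf} (h : schubertBasis.repr p w ≠ 0) : w.length = d := by
  have h1 := homogeneousComponent_linearCombination d (schubertBasis.repr p)
  rw [linearCombination_repr, homogeneousComponent_eq_self hp] at h1
  nth_rewrite 1 [← linearCombination_repr p] at h1
  have h2 := linearIndependent_schubert h1
  by_contra hw
  rw [h2, Finsupp.filter_apply_neg (fun w : SInf => w.length = d) _ hw] at h
  exact h rfl

theorem length_of_structureConst_ne_zero {u v w : SInf} (h : structureConst u v w ≠ 0) :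
    w.length = u.length + v.length := by
  rw [structureConst_eq] at h
  exact length_eq_of_repr_ne_zero ((isHomogeneous_schubert u).mul (isHomogeneous_schubert v)) h

/-! ### Chains and powers of a linear form -/

theorem X_mul_schubert_eq_sum {n k : ℕ} {w : SInf} (hw : Fixes n w) (hk : k < n) :
    X k * schubert w = ∑ j ∈ Finset.range (n + 1), monkTerm k w j := by
  rw [X_mul_schubert]
  refine finsum_eq_sum_of_support_subset _ fun j hj => ?_
  by_contra hc
  rw [Finset.mem_coe, Finset.mem_range] at hc
  exact hj (monkTerm_eq_zero hw hk (by omega))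

/-- Monk's rule: multiplication by `x_0 + ⋯ + x_k`, which is the Schubert polynomial of `s_k`. The
terms `±𝔖_{w (a, b)}` with `a, b ≤ k` cancel in pairs. -/
theorem sum_X_mul_schubert {n k : ℕ} {w : SInf} (hw : Fixes n w) (hk : k < n) :
    (∑ a ∈ Finset.range (k + 1), X a) * schubert w =
      ∑ a ∈ Finset.range (k + 1), ∑ b ∈ Finset.Ico (k + 1) (n + 1), monkTerm a w b := by
  have h0 : ∑ a ∈ Finset.range (k + 1), ∑ b ∈ Finset.range (k + 1), monkTerm a w b = 0 := by
    have h1 : ∑ a ∈ Finset.range (k + 1), ∑ b ∈ Finset.range (k + 1), monkTerm a w b =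
        -∑ a ∈ Finset.range (k + 1), ∑ b ∈ Finset.range (k + 1), monkTerm a w b := by
      conv_lhs => rw [Finset.sum_comm]
      simp only [← Finset.sum_neg_distrib]
      exact Finset.sum_congr rfl fun a _ => Finset.sum_congr rfl fun b _ =>
        monkTerm_antisymm b w a
    exact self_eq_neg.mp h1
  rw [Finset.sum_mul, ← zero_add (∑ a ∈ _, ∑ b ∈ _, _), ← h0, ← Finset.sum_add_distrib]
  refine Finset.sum_congr rfl fun a ha => ?_
  rw [Finset.mem_range] at ha
  rw [X_mul_schubert_eq_sum hw (by omega), Finset.range_eq_Ico, Finset.range_eq_Ico,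
    Finset.sum_Ico_consecutive _ (by omega) (by omega)]

open Classical in
/-- The sum of the Schubert polynomials of the `s_k` with `k ∈ I`, `k < n`. -/
noncomputable def colourForm (I : Set ℕ) (n : ℕ) : MvPolynomial ℕ ℤ :=
  ∑ k ∈ (Finset.range n).filter (· ∈ I), ∑ a ∈ Finset.range (k + 1), X a

open Classical in
/-- The triples `(k, a, b)` of a cover `u ⋖ u (a, b)` with colour `k ∈ I`, `a ≤ k < b`, within the
range `k < n`, `b ≤ m`. -/
noncomputable def colouredCovers (I : Set ℕ) (n m : ℕ) (u : SInf) : Finset (Σ _ : ℕ, ℕ × ℕ) :=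
  ((Finset.range n).filter (· ∈ I)).sigma fun k =>
    (Finset.range (k + 1) ×ˢ Finset.Ico (k + 1) (m + 1)).filter fun p =>
      u.length + 1 = (u * transp p.1 p.2).length

theorem mem_colouredCovers {I : Set ℕ} {n m k a b : ℕ} {u : SInf} :
    ⟨k, a, b⟩ ∈ colouredCovers I n m u ↔ k < n ∧ k ∈ I ∧ a ≤ k ∧ k < b ∧ b ≤ m ∧
      u.length + 1 = (u * transp a b).length := by
  simp only [colouredCovers, Finset.mem_sigma, Finset.mem_filter, Finset.mem_range,
    Finset.mem_product, Finset.mem_Ico]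
  constructor
  · rintro ⟨⟨h1, h2⟩, ⟨h3, h4, h5⟩, h6⟩
    exact ⟨h1, h2, by omega, by omega, by omega, h6⟩
  · rintro ⟨h1, h2, h3, h4, h5, h6⟩
    exact ⟨⟨h1, h2⟩, ⟨by omega, by omega, by omega⟩, h6⟩

theorem colourForm_mul_schubert (I : Set ℕ) {n m : ℕ} (hnm : n ≤ m) {u : SInf} (hu : Fixes m u) :
    colourForm I n * schubert u =
      ∑ s ∈ colouredCovers I n m u, schubert (u * transp s.2.1 s.2.2) := by
  classical
  rw [colourForm, colouredCovers, Finset.sum_sigma, Finset.sum_mul]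
  refine Finset.sum_congr rfl fun k hk => ?_
  rw [Finset.mem_filter, Finset.mem_range] at hk
  rw [sum_X_mul_schubert hu (by omega), Finset.sum_filter, Finset.sum_product]
  refine Finset.sum_congr rfl fun a ha => Finset.sum_congr rfl fun b hb => ?_
  rw [Finset.mem_range] at ha
  rw [Finset.mem_Ico] at hb
  rw [monkTerm, if_pos (show a < b by omega)]

end SInf

namespace IChain

open SInf

variable {I : Set ℕ} {u w : SInf}

theorem length_le (c : IChain I u w) : u.length ≤ w.length := by
  induction c with
  | nil => exact le_rfl
  | cons a b k hab hcover hak hkb hkI rest ih => omega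

theorem eq_nil (c : IChain I u w) (h : w.length ≤ u.length) :
    ∃ e : u = w, c = e ▸ IChain.nil u := by
  cases c with
  | nil => exact ⟨rfl, rfl⟩
  | cons a b k hab hcover hak hkb hkI rest =>
    have := rest.length_le
    omega

/-- A chain that ends in `𝒮_n` stays in `𝒮_n`. -/
theorem fixes {n : ℕ} (c : IChain I u w) (hw : Fixes n w) : Fixes n u := by
  induction c with
  | nil => exact hw
  | cons a b k hab hcover hak hkb hkI rest ih => exact (Fixes.of_cover hab hcover (ih hw)).2

/-- Prepending a coloured cover to a chain. -/
def prepend {n m : ℕ} (x : Σ s : colouredCovers I n m u, IChain I (u * transp s.1.2.1 s.1.2.2) w) :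
    IChain I u w :=
  have h := mem_colouredCovers.mp x.1.2
  IChain.cons x.1.1.2.1 x.1.1.2.2 x.1.1.1 (lt_of_le_of_lt h.2.2.1 h.2.2.2.1)
    h.2.2.2.2.2 h.2.2.1 h.2.2.2.1 h.2.1 x.2

theorem prepend_injective {n m : ℕ} :
    Function.Injective (prepend (I := I) (u := u) (w := w) (n := n) (m := m)) := by
  rintro ⟨⟨⟨k, a, b⟩, h⟩, c⟩ ⟨⟨⟨k', a', b'⟩, h'⟩, c'⟩ he
  simp only [prepend, IChain.cons.injEq] at he
  obtain ⟨rfl, rfl, rfl, he⟩ := he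
  rw [eq_of_heq he]

/-- A chain inside `𝒮_n` uses only colours less than `n`. -/
theorem prepend_surjective {n m : ℕ} (hnm : n ≤ m) (hw : Fixes n w) (huw : u ≠ w) :
    Function.Surjective (prepend (I := I) (u := u) (w := w) (n := n) (m := m)) := by
  intro c
  cases c with
  | nil => exact absurd rfl huw
  | cons a b k hab hcover hak hkb hkI rest =>
    have hb := (Fixes.of_cover hab hcover (rest.fixes hw)).1
    exact ⟨⟨⟨⟨k, a, b⟩, mem_colouredCovers.mpr
      ⟨by omega, hkI, hak, hkb, by omega, hcover⟩⟩, rest⟩, rfl⟩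

instance finite : Finite (IChain I u w) := by
  induction hd : w.length - u.length using Nat.strong_induction_on generalizing u with
  | _ d ih =>
    subst hd
    by_cases h : w.length ≤ u.length
    · have : Subsingleton (IChain I u w) := by
        constructor
        intro c c'
        obtain ⟨_, rfl⟩ := c.eq_nil h
        obtain ⟨_, rfl⟩ := c'.eq_nil h
        rfl
      infer_instance
    · obtain ⟨n, hn⟩ := exists_fixes w
      have hfin : ∀ s : colouredCovers I n n u,
          Finite (IChain I (u * transp s.1.2.1 s.1.2.2) w) := by
        rintro ⟨⟨k, a, b⟩, hs⟩
        have := (mem_colouredCovers.mp hs).2.2.2.2.2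
        exact ih _ (by simp only; omega) rfl
      exact Finite.of_surjective _ (prepend_surjective (n := n) (m := n) le_rfl hn
        fun e => h (by rw [e]))

end IChain

namespace SInf

open MvPolynomial

theorem chainCount_eq_sum {I : Set ℕ} {n m : ℕ} (hnm : n ≤ m) {u w : SInf} (hw : Fixes n w)
    (huw : u ≠ w) :
    chainCount I u w =
      ∑ s ∈ colouredCovers I n m u, chainCount I (u * transp s.2.1 s.2.2) w := by
  rw [chainCount, ← Nat.card_congr (Equiv.ofBijective _
    ⟨IChain.prepend_injective (n := n) (m := m), IChain.prepend_surjective hnm hw huw⟩),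
    Nat.card_sigma]
  exact Finset.sum_coe_sort (colouredCovers I n m u)
    fun s => chainCount I (u * transp s.2.1 s.2.2) w

theorem chainCount_self (I : Set ℕ) (w : SInf) : chainCount I w w = 1 := by
  rw [chainCount, Nat.card_eq_one_iff_unique]
  refine ⟨⟨fun c c' => ?_⟩, ⟨IChain.nil w⟩⟩
  obtain ⟨_, rfl⟩ := c.eq_nil le_rfl
  obtain ⟨_, rfl⟩ := c'.eq_nil le_rfl
  rfl

theorem chainCount_eq_zero {I : Set ℕ} {u w : SInf} (h : w.length ≤ u.length) (huw : u ≠ w) :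
    chainCount I u w = 0 := by
  have : IsEmpty (IChain I u w) := ⟨fun c => huw (c.eq_nil h).1⟩
  exact Nat.card_of_isEmpty

/-- The `I`-chains from `u` to `w` are counted by the coefficient of `𝔖_w` in `q^m 𝔖_u`, where `q`
is the sum of the `𝔖_{s_k}` with `k ∈ I`, restricted to the colours that matter for `w`. -/
theorem repr_colourForm_pow_mul (I : Set ℕ) {n m : ℕ} {u w : SInf} (hw : Fixes n w)
    (hm : w.length = u.length + m) :
    schubertBasis.repr (colourForm I n ^ m * schubert u) w = chainCount I u w := by
  induction m generalizing u with
  | zero =>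
    rw [pow_zero, one_mul, repr_schubert]
    by_cases h : u = w
    · rw [h, Finsupp.single_eq_same, chainCount_self, Nat.cast_one]
    · rw [chainCount_eq_zero (by omega) h, Finsupp.single_eq_of_ne' h, Nat.cast_zero]
  | succ m ih =>
    obtain ⟨l, hl⟩ := exists_fixes u
    have huw : u ≠ w := by
      rintro rfl
      omega
    rw [pow_succ, mul_assoc,
      colourForm_mul_schubert I (le_max_left n l) (hl.mono (le_max_right n l)), Finset.mul_sum,
      map_sum, Finsupp.finsetSum_apply, chainCount_eq_sum (le_max_left n l) hw huw, Nat.cast_sum]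
    refine Finset.sum_congr rfl ?_
    rintro ⟨k, a, b⟩ hs
    have := (mem_colouredCovers.mp hs).2.2.2.2.2
    exact ih (by simp only; omega)

/-- The coefficients of `q^m` in the Schubert basis count chains from the identity, wherever a
structure constant `c^w_{u v}` does not vanish. -/
theorem structureConst_mul_chainCount (I : Set ℕ) {n m : ℕ} {u w : SInf} (hw : Fixes n w)
    (hm : w.length = u.length + m) (v : SInf) :
    structureConst u v w * (chainCount I 1 v : ℤ) =
      structureConst u v w * schubertBasis.repr (colourForm I n ^ m) v := by
  by_cases h : structureConst u v w = 0
  · rw [h, zero_mul, zero_mul]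
  · have h1 := length_of_structureConst_ne_zero h
    have h2 := repr_colourForm_pow_mul I (u := 1) (m := m)
      (fixes_of_structureConst_ne_zero hw h) (by rw [length_one]; omega)
    rw [schubert_one, mul_one] at h2
    rw [h2]

end SInf

open SInf in
theorem theorem1p1 :
    (∃ B : Module.Basis SInf ℤ (MvPolynomial ℕ ℤ), ∀ x, B x = schubert x) ∧
    ∀ (u w : SInf) (I : Set ℕ),
      Finite (IChain I u w) ∧
      (Function.support fun v : SInf => structureConst u v w * (chainCount I 1 v : ℤ)).Finite ∧
      (chainCount I u w : ℤ) = ∑ᶠ v : SInf, structureConst u v w * (chainCount I 1 v : ℤ) := by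
  refine ⟨⟨schubertBasis, schubertBasis_apply⟩, fun u w I => ⟨IChain.finite, ?_⟩⟩
  by_cases hlen : u.length ≤ w.length
  · obtain ⟨n, hw⟩ := exists_fixes w
    obtain ⟨m, hm⟩ := Nat.exists_eq_add_of_le hlen
    rw [funext (structureConst_mul_chainCount I hw hm), ← repr_colourForm_pow_mul I hw hm]
    set q := colourForm I n ^ m
    have hsupp : (Function.support fun v =>
        structureConst u v w * schubertBasis.repr q v) ⊆ (schubertBasis.repr q).support :=
      fun v hv => Finsupp.mem_support_iff.mpr fun h => hv (by simp only [h, mul_zero])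
    refine ⟨(Finset.finite_toSet _).subset hsupp, ?_⟩
    rw [finsum_eq_sum_of_support_subset _ hsupp]
    conv_lhs => rw [← linearCombination_repr q, Finsupp.linearCombination_apply, Finsupp.sum,
      Finset.sum_mul, map_sum, Finsupp.finsetSum_apply]
    refine Finset.sum_congr rfl fun v _ => ?_
    rw [smul_mul_assoc, map_smul, Finsupp.smul_apply, smul_eq_mul, structureConst_eq,
      mul_comm (schubert v), mul_comm]
  · have h0 : ∀ v, structureConst u v w * (chainCount I 1 v : ℤ) = 0 := fun v => by
      by_contra h
      have := length_of_structureConst_ne_zero (left_ne_zero_of_mul h)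
      omega
    rw [funext h0, chainCount_eq_zero (by omega) (by rintro rfl; omega)]
    refine ⟨?_, by simp⟩
    simp
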